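/- Let $k$ be an algebraically closed field of characteristic $\neq 2$. A superalgebra over $k$ is a $k$-algebra $A=A_{\bar 0}\oplus A_{\bar 1}$ with $A_{\bar i}A_{\bar j}\subseteq A_{\overline{i+j}}$ for $\bar i,\bar j\in\mathbb{Z}/2$; write $|a|$ for the parity of a homogeneous element $a$. A Jordan superalgebra is a superalgebra $J=J_{\bar 0}\oplus J_{\bar 1}$ such that, for all homogeneous $a,b,c,d\in J$, $$ab=(-1)^{|a||b|}ba,$$ $$(ab)(cd)+(-1)^{|b||c|}(ac)(bd)+(-1)^{|b||d|+|c||d|}(ad)(bc)$$ $$=((ab)c)d+(-1)^{|b||c|+|b||d|+|c||d|}((ad)c)b+(-1)^{|a||b|+|a||c|+|a||d|+|c||d|}((bd)c)a,$$ and $a^2(ba)=(a^2b)a$ for all $a\in J_{\bar 0}$ and $b\in J$ (this last condition follows from the other two when $\operatorname{char}k\neq 3$). For an associative superalgebra $A$ over $k$, let $A^{(+)}$ be the superspace $A$ with the product determined by $a\odot b=\tfrac12\bigl(ab+(-1)^{|a||b|}ba\bigr)$ for homogeneous $a,b$. A Jordan superalgebra is special if it is isomorphic, as a superalgebra, to a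 sub-superalgebra of $A^{(+)}$ for some associative superalgebra $A$ over $k$, and exceptional otherwise. Then exceptional Jordan superalgebras of finite dimension over $k$ exist, and the minimal dimension $d$ of an exceptional Jordan superalgebra over $k$ satisfies $4\le d\le 7$. -/

import Mathlib

universe u v w

/-- The sign `(-1)^m` attached to a parity `m : ZMod 2`, as an element of `k`. The product `i * j`
of parities is computed in `ZMod 2`, so `superSign k (i * j)` is `(-1)^(|a||b|)`. -/
def superSign (k : Type u) [Field k] (m : ZMod 2) : k := (-1) ^ m.val

/-- `𝒜 0 ⊕ 𝒜 1` is a `ZMod 2`-grading of the (not necessarily associative or unital)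
`k`-algebra `A`: the superspace is the direct sum of its even and odd part, and
`𝒜 i * 𝒜 j ⊆ 𝒜 (i + j)`. -/
structure IsSuperalgebra (k : Type u) {A : Type v} [Field k] [NonUnitalNonAssocRing A]
    [Module k A] (𝒜 : ZMod 2 → Submodule k A) : Prop where
  isInternal : DirectSum.IsInternal 𝒜
  mul_mem : ∀ (i j : ZMod 2) (a b : A), a ∈ 𝒜 i → b ∈ 𝒜 j → a * b ∈ 𝒜 (i + j)

/-- Jordan superalgebras: supercommutativity and the super Jordan identity for homogeneous
elements, and the (unlinearized) Jordan identity `a² (b a) = (a² b) a` for even `a`.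

The last clause says that the even part is a Jordan algebra acting on the odd part as on a Jordan
bimodule. Up to a factor `3` it is the super Jordan identity at `(a, a, b, a)`, so it is a
consequence of the other clauses unless `k` has characteristic `3`. In every characteristic
different from `2` the clauses together say that the Grassmann envelope is a Jordan algebra. -/
structure IsJordanSuperalgebra (k : Type u) {J : Type v} [Field k] [NonUnitalNonAssocRing J]
    [Module k J] (𝒥 : ZMod 2 → Submodule k J) : Prop extends IsSuperalgebra k 𝒥 where
  supercomm : ∀ (p q : ZMod 2) (a b : J), a ∈ 𝒥 p → b ∈ 𝒥 q →
    a * b = superSign k (p * q) • (b * a)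
  super_jordan : ∀ (p q r s : ZMod 2) (a b c d : J),
    a ∈ 𝒥 p → b ∈ 𝒥 q → c ∈ 𝒥 r → d ∈ 𝒥 s →
    (a * b) * (c * d)
      + superSign k (q * r) • ((a * c) * (b * d))
      + superSign k (q * s + r * s) • ((a * d) * (b * c))
    = ((a * b) * c) * d
      + superSign k (q * r + q * s + r * s) • (((a * d) * c) * b)
      + superSign k (p * q + p * r + p * s + r * s) • (((b * d) * c) * a)
  even_jordan : ∀ a b : J, a ∈ 𝒥 0 → (a * a) * (b * a) = ((a * a) * b) * a

/-- The product `a ⊙ b = ½ (a b + (-1)^(|a||b|) b a)` of `A⁽⁺⁾`, for homogeneous elements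
`a`, `b` of parities `i`, `j` of an associative superalgebra `A`. -/
def plusMul (k : Type u) {A : Type v} [Field k] [NonUnitalRing A] [Module k A]
    (i j : ZMod 2) (a b : A) : A :=
  (2 : k)⁻¹ • (a * b + superSign k (i * j) • (b * a))

/-- `φ` identifies the superalgebra `J` with a sub-superalgebra of `A⁽⁺⁾`: it is linear, injective,
preserves parities, and carries the product of `J` to the product `⊙` of `A⁽⁺⁾`
(both products being bilinear, it suffices to say this for homogeneous elements). -/
structure IsPlusEmbedding (k : Type u) {J : Type v} {A : Type w} [Field k]
    [NonUnitalNonAssocRing J] [Module k J] [NonUnitalRing A] [Module k A]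
    (𝒥 : ZMod 2 → Submodule k J) (𝒜 : ZMod 2 → Submodule k A) (φ : J →ₗ[k] A) : Prop where
  injective : Function.Injective φ
  map_mem : ∀ (i : ZMod 2) (a : J), a ∈ 𝒥 i → φ a ∈ 𝒜 i
  map_mul : ∀ (i j : ZMod 2) (a b : J), a ∈ 𝒥 i → b ∈ 𝒥 j →
    φ (a * b) = plusMul k i j (φ a) (φ b)

/-- `J` is special: it is (isomorphic to) a sub-superalgebra of `A⁽⁺⁾` for some associative
superalgebra `A` over `k` (not required to be unital or finite-dimensional). -/
def IsSpecialSuperalgebra (k : Type u) {J : Type u} [Field k] [NonUnitalNonAssocRing J]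
    [Module k J] (𝒥 : ZMod 2 → Submodule k J) : Prop :=
  ∃ (A : Type u) (_ : NonUnitalRing A) (_ : Module k A) (_ : SMulCommClass k A A)
    (_ : IsScalarTower k A A) (𝒜 : ZMod 2 → Submodule k A) (φ : J →ₗ[k] A),
    IsSuperalgebra k 𝒜 ∧ IsPlusEmbedding k 𝒥 𝒜 φ

/-- An exceptional Jordan superalgebra is a Jordan superalgebra that is not special. -/
def IsExceptionalJordanSuperalgebra (k : Type u) {J : Type u} [Field k]
    [NonUnitalNonAssocRing J] [Module k J] (𝒥 : ZMod 2 → Submodule k J) : Prop :=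
  IsJordanSuperalgebra k 𝒥 ∧ ¬ IsSpecialSuperalgebra k 𝒥

/-- The set of all `n : ℕ` such that there is an exceptional Jordan superalgebra of (finite)
dimension `n` over `k`. -/
def exceptionalDimensions (k : Type u) [Field k] : Set ℕ :=
  {n | ∃ (J : Type u) (_ : NonUnitalNonAssocRing J) (_ : Module k J) (_ : SMulCommClass k J J)
    (_ : IsScalarTower k J J) (𝒥 : ZMod 2 → Submodule k J),
    IsExceptionalJordanSuperalgebra k 𝒥 ∧ FiniteDimensional k J ∧ Module.finrank k J = n}

/-!
The upper bound comes from a five-dimensional superalgebra `KantorLieDouble`, with even basis `a`,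
`b` and odd basis `x`, `ax`, `bx`, cut out of the Kantor double of a Poisson algebra whose bracket
`{a, b} = a` is not nilpotent of class two. In an associative superalgebra containing it, `x²`
commutes with `a` and `b`, and `ax · bx = a` expands to `4a = 2abx² + sx + xs` with `s = axb`.
Since `b² = bxb = 0`, right multiplication by `b` and then by `xb` kills the summands one after the
other, and `a = 0` (`KantorLieDouble.eq_zero_of_relations`).

For the lower bound every Jordan superalgebra `J` of dimension at most three is shown to be
special. By `IsJordanSuperalgebra.isSpecial_of_ungraded` an ungraded associative algebra in which
the signed products hold is enough.

If the odd part has dimension at most one, odd elements have product zero and `J` may be regarded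
as an ordinary Jordan algebra `V`, which can be assumed to have dimension three. If some idempotent
`e` has an eigenvector of eigenvalue `½`, a third eigenvector completes a basis, the Jordan
identities leave few multiplication tables, and each is realized by `3 × 3` matrices
(`isSpecialProduct_of_half`). Otherwise `V` is associative: this follows by showing that the
multiplication operators of a spanning set commute. The tools are that idempotents are central,
that the operators of `a`, `a²`, `a³` commute, and that in the absence of idempotents either these
powers form a basis for some `a` or all cubes vanish.

If the odd part has dimension two or three and `J` has no even part, all products vanish. What is
left is the type `(1|2)`, with even part spanned by `e = e²` or by `n` with `n² = 0`. The Peirce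
eigenvalues of `e` on the odd part are restricted by the super Jordan identity. A nonzero odd
product needs operators `Z`, `W` whose commutator is a prescribed idempotent or unit; these are
found in the Weyl algebra acting on `k[X]`, which works in every characteristic. For `n² = 0`
nilpotent matrices suffice.
-/

set_option linter.unusedSimpArgs false

/-! ### A five-dimensional exceptional superalgebra -/

/-- A five-dimensional superspace with even coordinates `a`, `b` and odd coordinates `x`, `ax`,
`bx`. The nonzero products of the basis vectors are, up to supercommutativity, `a · x = ax`,
`b · x = bx` and `ax · bx = a`. It is a subalgebra of the Kantor double `Γ ⊕ Γx` of the Poisson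
algebra `Γ = k ⊕ ka ⊕ kb` with `a² = ab = b² = 0` and `{a, b} = a`: the unit of `Γ` is left out of
the even part. The last equation is the Kantor rule `(fx)(gx) = {f, g}`. -/
@[ext]
structure KantorLieDouble (k : Type u) where
  a : k
  b : k
  x : k
  ax : k
  bx : k

namespace KantorLieDouble

/-- Coordinates with respect to the basis `a`, `b`, `x`, `ax`, `bx`. -/
def equivFun (k : Type u) : KantorLieDouble k ≃ (Fin 5 → k) where
  toFun v := ![v.a, v.b, v.x, v.ax, v.bx]
  invFun f := ⟨f 0, f 1, f 2, f 3, f 4⟩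
  left_inv _ := rfl
  right_inv f := by ext i; fin_cases i <;> rfl

variable {k : Type u} [Field k]

instance : AddCommGroup (KantorLieDouble k) := (equivFun k).addCommGroup
instance : Module k (KantorLieDouble k) := (equivFun k).module k

instance : Mul (KantorLieDouble k) where
  mul v w :=
    { a := v.ax * w.bx - v.bx * w.ax
      b := 0
      x := 0
      ax := v.a * w.x + v.x * w.a
      bx := v.b * w.x + v.x * w.b }

theorem add_def (v w : KantorLieDouble k) :
    v + w = ⟨v.a + w.a, v.b + w.b, v.x + w.x, v.ax + w.ax, v.bx + w.bx⟩ := rfl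
theorem zero_def : (0 : KantorLieDouble k) = ⟨0, 0, 0, 0, 0⟩ := rfl
theorem smul_def (c : k) (v : KantorLieDouble k) :
    c • v = ⟨c * v.a, c * v.b, c * v.x, c * v.ax, c * v.bx⟩ := rfl
theorem mul_def (v w : KantorLieDouble k) :
    v * w = ⟨v.ax * w.bx - v.bx * w.ax, 0, 0, v.a * w.x + v.x * w.a, v.b * w.x + v.x * w.b⟩ := rfl

instance : NonUnitalNonAssocRing (KantorLieDouble k) where
  left_distrib u v w := by simp only [mul_def, add_def]; ext <;> simp <;> ring
  right_distrib u v w := by simp only [mul_def, add_def]; ext <;> simp <;> ring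
  zero_mul v := by simp [mul_def, zero_def]
  mul_zero v := by simp [mul_def, zero_def]

instance : SMulCommClass k (KantorLieDouble k) (KantorLieDouble k) where
  smul_comm c v w := by simp only [smul_eq_mul, mul_def, smul_def]; ext <;> simp <;> ring

instance : IsScalarTower k (KantorLieDouble k) (KantorLieDouble k) where
  smul_assoc c v w := by simp only [smul_eq_mul, mul_def, smul_def]; ext <;> simp <;> ring

/-- The coordinates as a linear equivalence. -/
def linearEquivFun (k : Type u) [Field k] : KantorLieDouble k ≃ₗ[k] (Fin 5 → k) :=
  (equivFun k).linearEquiv k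

instance : FiniteDimensional k (KantorLieDouble k) :=
  Module.Finite.equiv (linearEquivFun k).symm

theorem finrank_eq : Module.finrank k (KantorLieDouble k) = 5 := by
  rw [(linearEquivFun k).finrank_eq]; simp

variable (k) in
/-- The even part is spanned by `a`, `b` and the odd part by `x`, `ax`, `bx`. -/
def grading : ZMod 2 → Submodule k (KantorLieDouble k) :=
  ![{ carrier := {v | v.x = 0 ∧ v.ax = 0 ∧ v.bx = 0}
      add_mem' := by rintro v w ⟨h1, h2, h3⟩ ⟨h4, h5, h6⟩; simp [add_def, *]
      zero_mem' := by simp [zero_def]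
      smul_mem' := by rintro c v ⟨h1, h2, h3⟩; simp [smul_def, *] },
    { carrier := {v | v.a = 0 ∧ v.b = 0}
      add_mem' := by rintro v w ⟨h1, h2⟩ ⟨h4, h5⟩; simp [add_def, *]
      zero_mem' := by simp [zero_def]
      smul_mem' := by rintro c v ⟨h1, h2⟩; simp [smul_def, *] }]

theorem mem_grading_zero {v : KantorLieDouble k} :
    v ∈ grading k 0 ↔ v.x = 0 ∧ v.ax = 0 ∧ v.bx = 0 := Iff.rfl

theorem mem_grading_one {v : KantorLieDouble k} :
    v ∈ grading k 1 ↔ v.a = 0 ∧ v.b = 0 := Iff.rfl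

end KantorLieDouble

theorem superSign_zero (k : Type u) [Field k] : superSign k 0 = 1 := by simp [superSign]

theorem superSign_one (k : Type u) [Field k] : superSign k 1 = -1 := by
  simp [superSign, ZMod.val_one]

theorem ZMod.eq_zero_or_eq_one_of_two : ∀ i : ZMod 2, i = 0 ∨ i = 1 := by decide

namespace KantorLieDouble

variable {k : Type u} [Field k]

theorem isSuperalgebra : IsSuperalgebra k (grading k) where
  isInternal := by
    rw [DirectSum.isInternal_submodule_iff_isCompl (i := 0) (j := 1) _ (by decide)
      (by ext i; revert i; simp; decide)]
    refine IsCompl.of_eq ?_ ?_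
    · rw [eq_bot_iff]
      rintro v ⟨⟨h1, h2, h3⟩, h4, h5⟩
      exact KantorLieDouble.ext h4 h5 h1 h2 h3
    · rw [eq_top_iff]
      intro v _
      refine Submodule.mem_sup.2 ⟨⟨v.a, v.b, 0, 0, 0⟩, ⟨rfl, rfl, rfl⟩, ⟨0, 0, v.x, v.ax, v.bx⟩,
        ⟨rfl, rfl⟩, ?_⟩
      simp [add_def]
  mul_mem i j v w hv hw := by
    obtain rfl | rfl := ZMod.eq_zero_or_eq_one_of_two i <;>
    obtain rfl | rfl := ZMod.eq_zero_or_eq_one_of_two j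
    · obtain ⟨h1, h2, h3⟩ := hv
      obtain ⟨h4, h5, h6⟩ := hw
      rw [show (0 : ZMod 2) + 0 = 0 from rfl]
      simp [mem_grading_zero, mul_def, *]
    · obtain ⟨h1, h2, h3⟩ := hv
      obtain ⟨h4, h5⟩ := hw
      rw [show (0 : ZMod 2) + 1 = 1 from rfl]
      simp [mem_grading_one, mul_def, *]
    · obtain ⟨h1, h2⟩ := hv
      obtain ⟨h4, h5, h6⟩ := hw
      rw [show (1 : ZMod 2) + 0 = 1 from rfl]
      simp [mem_grading_one, mul_def, *]
    · obtain ⟨h1, h2⟩ := hv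
      obtain ⟨h4, h5⟩ := hw
      rw [show (1 : ZMod 2) + 1 = 0 from rfl]
      simp [mem_grading_zero, mul_def, *]

theorem isJordanSuperalgebra : IsJordanSuperalgebra k (grading k) where
  toIsSuperalgebra := isSuperalgebra
  supercomm p q v w hv hw := by
    have h11 : (1 : ZMod 2) * 1 = 1 := rfl
    obtain rfl | rfl := ZMod.eq_zero_or_eq_one_of_two p <;>
    obtain rfl | rfl := ZMod.eq_zero_or_eq_one_of_two q <;>
    simp only [mem_grading_zero, mem_grading_one] at hv hw <;>
    simp only [zero_mul, mul_zero, h11, superSign_zero,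
      superSign_one, mul_def, smul_def, hv, hw] <;>
    ext <;> dsimp only <;> ring
  super_jordan p q r s v w y z hv hw hy hz := by
    have h11 : (1 : ZMod 2) + 1 = 0 := rfl
    obtain rfl | rfl := ZMod.eq_zero_or_eq_one_of_two p <;>
    obtain rfl | rfl := ZMod.eq_zero_or_eq_one_of_two q <;>
    obtain rfl | rfl := ZMod.eq_zero_or_eq_one_of_two r <;>
    obtain rfl | rfl := ZMod.eq_zero_or_eq_one_of_two s <;>
    simp only [mem_grading_zero, mem_grading_one] at hv hw hy hz <;>
    simp only [zero_mul, mul_zero, mul_one, add_zero, zero_add, h11,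
      superSign_zero, superSign_one, mul_def, smul_def, add_def, hv, hw, hy, hz] <;>
    ext <;> dsimp only <;> ring
  even_jordan v w hv := by
    obtain ⟨h1, h2, h3⟩ := hv
    simp [mul_def, *]

/-- With `s = axb`, the last relation becomes `4a = 2abx² + sx + xs`. Multiplying it on the right
by `b` gives `ab = 0`, then multiplying by `xb` gives `s = 0`, so that `a = 0`. -/
theorem eq_zero_of_relations {A : Type*} [NonUnitalRing A] [Module k A]
    [IsScalarTower k A A] (h2 : (2 : k) ≠ 0)
    {a b x : A} (hbb : b * b = 0) (hab : b * a = -(a * b)) (hxab : x * (a * b) = a * b * x)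
    (hbxb : b * x * b = 0) (hbxa : b * x * a = -(a * x * b))
    (hxa : x * (x * a) = a * (x * x)) (hxb : x * (x * b) = b * (x * x))
    (h : (a * x + x * a) * (b * x + x * b) - (b * x + x * b) * (a * x + x * a) = (8 : k) • a) :
    a = 0 := by
  have cancel : ∀ y : A, (8 : k) • y = 0 → y = 0 := by
    intro y hy
    have h8 : (8 : k) ≠ 0 := by
      rw [show (8 : k) = 2 ^ 3 by norm_num]
      exact pow_ne_zero _ h2
    exact (smul_eq_zero.1 hy).resolve_left h8
  have hbb' : ∀ y, b * (b * y) = 0 := fun y => by rw [← mul_assoc, hbb, zero_mul]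
  have hbxa' : ∀ y, b * (x * (a * y)) = -(a * (x * (b * y))) := fun y => by
    simpa only [mul_assoc, neg_mul] using congrArg (· * y) hbxa
  have hab' : ∀ y, b * (a * y) = -(a * (b * y)) := fun y => by
    simpa only [mul_assoc, neg_mul] using congrArg (· * y) hab
  have hxab' : ∀ y, x * (a * (b * y)) = a * (b * (x * y)) := fun y => by
    simpa only [mul_assoc] using congrArg (· * y) hxab
  rw [mul_assoc] at hbxa hbxb
  have h1 : (8 : k) • a = (2 : k) • (a * (x * (b * x)) + x * (a * (x * b))
      + (2 : k) • (a * (b * (x * x)))) := by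
    rw [← h]
    simp only [add_mul, mul_add, mul_assoc, hbxa', hxa, hxb, hab', hxab', hbxa, mul_neg]
    module
  have hab0 : a * b = 0 := by
    apply cancel
    rw [← smul_mul_assoc, h1]
    simp only [smul_mul_assoc, add_mul, mul_assoc, hbxb, hbb, hxb, hbb', mul_zero, smul_zero,
      add_zero]
  have hab0' : ∀ y, a * (b * y) = 0 := fun y => by rw [← mul_assoc, hab0, zero_mul]
  have hs : a * (x * b) = 0 := by
    apply cancel
    rw [← smul_mul_assoc, h1]
    simp only [smul_mul_assoc, add_mul, mul_assoc, hbxb, hbb', hxb, hab0', mul_zero, smul_zero,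
      add_zero]
  have hs' : ∀ y, a * (x * (b * y)) = 0 := fun y => by
    simpa only [mul_assoc, zero_mul] using congrArg (· * y) hs
  apply cancel
  rw [h1, hs, hs', hab0', mul_zero, smul_zero, add_zero, add_zero, smul_zero]

/-- The images of the basis vectors in an associative superalgebra satisfy the hypotheses of
`eq_zero_of_relations`, so `a` would be sent to zero. -/
theorem not_isSpecial (h2 : (2 : k) ≠ 0) : ¬ IsSpecialSuperalgebra k (grading k) := by
  rintro ⟨A, _, _, _, _, 𝒜, φ, -, hφ⟩
  have h11 : (1 : ZMod 2) * 1 = 1 := rfl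
  -- The relations between the images of basis vectors, freed of the factor `1 / 2`.
  have heven : ∀ (i : ZMod 2) (v w : KantorLieDouble k), v ∈ grading k 0 → w ∈ grading k i →
      (2 : k) • φ (v * w) = φ v * φ w + φ w * φ v := by
    intro i v w hv hw
    rw [hφ.map_mul 0 i v w hv hw, plusMul, zero_mul, superSign_zero, one_smul, smul_inv_smul₀ h2]
  have hodd : ∀ v w : KantorLieDouble k, v ∈ grading k 1 → w ∈ grading k 1 →
      (2 : k) • φ (v * w) = φ v * φ w - φ w * φ v := by
    intro v w hv hw
    rw [hφ.map_mul 1 1 v w hv hw, plusMul, h11, superSign_one, smul_inv_smul₀ h2, neg_one_smul,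
      sub_eq_add_neg]
  have cancel : ∀ y : A, y + y = 0 → y = 0 := fun y hy => by
    rw [← two_smul k] at hy
    exact (smul_eq_zero.1 hy).resolve_left h2
  let a : KantorLieDouble k := ⟨1, 0, 0, 0, 0⟩
  let b : KantorLieDouble k := ⟨0, 1, 0, 0, 0⟩
  let x : KantorLieDouble k := ⟨0, 0, 1, 0, 0⟩
  let a' : KantorLieDouble k := ⟨0, 0, 0, 1, 0⟩
  let b' : KantorLieDouble k := ⟨0, 0, 0, 0, 1⟩
  have ha : a ∈ grading k 0 := ⟨rfl, rfl, rfl⟩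
  have hb : b ∈ grading k 0 := ⟨rfl, rfl, rfl⟩
  have hx : x ∈ grading k 1 := ⟨rfl, rfl⟩
  have ha' : a' ∈ grading k 1 := ⟨rfl, rfl⟩
  have hb' : b' ∈ grading k 1 := ⟨rfl, rfl⟩
  have hbb := heven 0 b b hb hb
  have hab := heven 0 a b ha hb
  have hax := heven 1 a x ha hx
  have hbx := heven 1 b x hb hx
  have hab' := heven 1 a b' ha hb'
  have hba' := heven 1 b a' hb ha'
  have hbb' := heven 1 b b' hb hb'
  have hxa' := hodd x a' hx ha'
  have hxb' := hodd x b' hx hb'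
  have hab'' := hodd a' b' ha' hb'
  rw [show b * b = 0 by simp [mul_def, b, zero_def], map_zero, smul_zero] at hbb
  rw [show a * b = 0 by simp [mul_def, a, b, zero_def], map_zero, smul_zero] at hab
  rw [show a * x = a' by simp [mul_def, a, x, a']] at hax
  rw [show b * x = b' by simp [mul_def, b, x, b']] at hbx
  rw [show a * b' = 0 by simp [mul_def, a, b', zero_def], map_zero, smul_zero] at hab'
  rw [show b * a' = 0 by simp [mul_def, b, a', zero_def], map_zero, smul_zero] at hba'
  rw [show b * b' = 0 by simp [mul_def, b, b', zero_def], map_zero, smul_zero] at hbb'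
  rw [show x * a' = 0 by simp [mul_def, x, a', zero_def], map_zero, smul_zero] at hxa'
  rw [show x * b' = 0 by simp [mul_def, x, b', zero_def], map_zero, smul_zero] at hxb'
  rw [show a' * b' = a by simp [mul_def, a, a', b']] at hab''
  have ha0 : φ a ≠ 0 := by
    rw [Ne, ← map_zero φ, hφ.injective.eq_iff]
    exact fun h => one_ne_zero (congrArg KantorLieDouble.a h)
  clear_value a b x a' b'
  generalize φ a = a at *
  generalize φ b = b at *
  generalize φ x = x at *
  generalize φ a' = a' at *
  generalize φ b' = b' at *
  have hbb0 : b * b = 0 := cancel _ hbb.symm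
  have hba0 : b * a = -(a * b) := (neg_eq_of_add_eq_zero_right hab.symm).symm
  have e3 : b * (b * x + x * b) + (b * x + x * b) * b = 0 := by
    rw [← hbx, mul_smul_comm, smul_mul_assoc, ← smul_add, ← hbb', smul_zero]
  have e4 : a * (b * x + x * b) + (b * x + x * b) * a = 0 := by
    rw [← hbx, mul_smul_comm, smul_mul_assoc, ← smul_add, ← hab', smul_zero]
  have e5 : b * (a * x + x * a) + (a * x + x * a) * b = 0 := by
    rw [← hax, mul_smul_comm, smul_mul_assoc, ← smul_add, ← hba', smul_zero]
  have e6 : x * (a * x + x * a) - (a * x + x * a) * x = 0 := by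
    rw [← hax, mul_smul_comm, smul_mul_assoc, ← smul_sub, ← hxa', smul_zero]
  have e7 : x * (b * x + x * b) - (b * x + x * b) * x = 0 := by
    rw [← hbx, mul_smul_comm, smul_mul_assoc, ← smul_sub, ← hxb', smul_zero]
  have e8 : (a * x + x * a) * (b * x + x * b) - (b * x + x * b) * (a * x + x * a)
      = (8 : k) • a := by
    rw [← hax, ← hbx, smul_mul_smul_comm, smul_mul_smul_comm, ← smul_sub, ← hab'', smul_smul]
    norm_num
  have hba0' : ∀ y, b * (a * y) = -(a * (b * y)) := fun y => by
    rw [← mul_assoc, hba0, neg_mul, mul_assoc]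
  have hbb0' : ∀ y, b * (b * y) = 0 := fun y => by rw [← mul_assoc, hbb0, zero_mul]
  simp only [mul_add, add_mul, mul_assoc, hba0, hba0', hbb0, hbb0', mul_neg, mul_zero] at e3 e4 e5
  simp only [mul_add, add_mul, mul_assoc] at e6 e7
  have hbxa : b * x * a = -(a * x * b) := by
    rw [← add_eq_zero_iff_eq_neg, mul_assoc, mul_assoc]
    apply cancel
    rw [← add_zero (0 : A)]
    nth_rewrite 1 [← e4]
    rw [← e5]
    abel
  refine ha0 (eq_zero_of_relations h2 hbb0 hba0 ?_ ?_ hbxa ?_ ?_ e8)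
  · rw [mul_assoc, mul_assoc] at hbxa
    rw [hbxa] at e5
    rw [← sub_eq_zero, ← e5, mul_assoc]
    abel
  · rw [mul_assoc]
    apply cancel
    rw [← e3]
    abel
  · rw [← sub_eq_zero, ← e6]
    abel
  · rw [← sub_eq_zero, ← e7]
    abel

theorem five_mem_exceptionalDimensions (h2 : (2 : k) ≠ 0) : 5 ∈ exceptionalDimensions k :=
  ⟨KantorLieDouble k, inferInstance, inferInstance, inferInstance, inferInstance, grading k,
    ⟨isJordanSuperalgebra, not_isSpecial h2⟩, inferInstance, finrank_eq⟩

end KantorLieDouble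

/-! ### Jordan algebras of dimension three: Peirce decomposition -/

section JordanProduct

variable {k : Type u} {V : Type u} [Field k] [AddCommGroup V] [Module k V]

/-- A bilinear product `μ` that makes `V` a Jordan algebra. The linearized identity is a separate
clause because in characteristic `3` it does not yield the unlinearized one. Products are bundled
as bilinear maps rather than ring structures so that several of them can live on one space. -/
structure IsJordanProduct (μ : V →ₗ[k] V →ₗ[k] V) : Prop where
  comm : ∀ a b, μ a b = μ b a
  linearized : ∀ a b c d,
    μ (μ a b) (μ c d) + μ (μ a c) (μ b d) + μ (μ a d) (μ b c)
      = μ (μ (μ a b) c) d + μ (μ (μ a d) c) b + μ (μ (μ b d) c) a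
  jordan : ∀ a b, μ (μ a a) (μ b a) = μ (μ (μ a a) b) a

/-- `μ` is realized as `½ (ab + ba)` on a subspace of an associative algebra. The factor `2` is put
on the other side. -/
def IsSpecialProduct (μ : V →ₗ[k] V →ₗ[k] V) : Prop :=
  ∃ (B : Type u) (_ : NonUnitalRing B) (_ : Module k B) (_ : IsScalarTower k B B)
    (_ : SMulCommClass k B B) (σ : V →ₗ[k] B), Function.Injective σ ∧
      ∀ a b, (2 : k) • σ (μ a b) = σ a * σ b + σ b * σ a

/-- A commutative associative algebra is its own special envelope. -/
theorem isSpecialProduct_of_assoc {μ : V →ₗ[k] V →ₗ[k] V} (hcomm : ∀ a b, μ a b = μ b a)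
    (hassoc : ∀ a b c, μ (μ a b) c = μ a (μ b c)) : IsSpecialProduct μ := by
  let R : NonUnitalRing V :=
    { (inferInstance : AddCommGroup V) with
      mul := fun a b => μ a b
      left_distrib := fun a b c => map_add (μ a) b c
      right_distrib := fun a b c => by
        show μ (a + b) c = μ a c + μ b c
        rw [map_add, LinearMap.add_apply]
      zero_mul := fun a => by show μ 0 a = 0; rw [map_zero, LinearMap.zero_apply]
      mul_zero := fun a => map_zero (μ a)
      mul_assoc := hassoc }
  refine ⟨V, R, inferInstance, ⟨fun c a b => ?_⟩, ⟨fun c a b => ?_⟩, LinearMap.id,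
    fun _ _ h => h, fun a b => ?_⟩
  · show μ (c • a) b = c • μ a b
    rw [map_smul, LinearMap.smul_apply]
  · show c • μ a b = μ a (c • b)
    rw [map_smul]
  · show (2 : k) • μ a b = μ a b + μ b a
    rw [hcomm b a, two_smul]

section Basis

variable {x y z : V}

theorem exists_coords_of_linearIndependent (hV : Module.finrank k V = 3)
    (h : LinearIndependent k ![x, y, z]) (v : V) : ∃ p q r : k, v = p • x + q • y + r • z := by
  have : FiniteDimensional k V := Module.finite_of_finrank_eq_succ hV
  let b := basisOfLinearIndependentOfCardEqFinrank h (by simp [hV])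
  refine ⟨b.repr v 0, b.repr v 1, b.repr v 2, ?_⟩
  conv_lhs => rw [← b.sum_repr v]
  simp [Fin.sum_univ_three, b]

theorem linearIndependent_triple_of_notMem (hxy : LinearIndependent k ![x, y])
    (hz : z ∉ Submodule.span k {x, y}) : LinearIndependent k ![z, x, y] := by
  exact linearIndependent_finCons.2 ⟨hxy, by simpa [Set.pair_comm] using hz⟩

theorem span_pair_ne_top (hV : Module.finrank k V = 3) (x y : V) :
    Submodule.span k {x, y} ≠ ⊤ := by
  intro h
  classical
  have h1 := finrank_span_finset_le_card (R := k) ({x, y} : Finset V)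
  simp only [Finset.coe_insert, Finset.coe_singleton] at h1
  rw [Set.finrank, h, finrank_top, hV] at h1
  exact absurd (h1.trans Finset.card_le_two) (by norm_num)

theorem exists_notMem_span_pair (hV : Module.finrank k V = 3) (x y : V) :
    ∃ v, v ∉ Submodule.span k {x, y} := by
  by_contra! h
  exact span_pair_ne_top hV x y (eq_top_iff.2 fun v _ => h v)

theorem exists_relation_of_not_linearIndependent (h : ¬ LinearIndependent k ![x, y, z]) :
    ∃ p q r : k, p • x + q • y + r • z = 0 ∧ ¬ (p = 0 ∧ q = 0 ∧ r = 0) := by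
  rw [Fintype.not_linearIndependent_iff] at h
  obtain ⟨g, hg, i, hi⟩ := h
  refine ⟨g 0, g 1, g 2, by simpa [Fin.sum_univ_three] using hg, fun ⟨h0, h1, h2⟩ => hi ?_⟩
  fin_cases i <;> assumption

/-- In dimension three it suffices to choose images `X`, `Y`, `Z` of a basis and to compare the six
products of basis vectors. -/
theorem isSpecialProduct_of_triple {μ : V →ₗ[k] V →ₗ[k] V} (hcomm : ∀ a b, μ a b = μ b a)
    (hV : Module.finrank k V = 3) (h : LinearIndependent k ![x, y, z])
    {B : Type u} [NonUnitalRing B] [Module k B] [IsScalarTower k B B] [SMulCommClass k B B]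
    (X Y Z : B) (hinj : ∀ p q r : k, p • X + q • Y + r • Z = 0 → p = 0 ∧ q = 0 ∧ r = 0)
    (hxx : ∃ p q r : k, μ x x = p • x + q • y + r • z ∧
      X * X + X * X = (2 : k) • (p • X + q • Y + r • Z))
    (hyy : ∃ p q r : k, μ y y = p • x + q • y + r • z ∧
      Y * Y + Y * Y = (2 : k) • (p • X + q • Y + r • Z))
    (hzz : ∃ p q r : k, μ z z = p • x + q • y + r • z ∧
      Z * Z + Z * Z = (2 : k) • (p • X + q • Y + r • Z))
    (hxy : ∃ p q r : k, μ x y = p • x + q • y + r • z ∧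
      X * Y + Y * X = (2 : k) • (p • X + q • Y + r • Z))
    (hxz : ∃ p q r : k, μ x z = p • x + q • y + r • z ∧
      X * Z + Z * X = (2 : k) • (p • X + q • Y + r • Z))
    (hyz : ∃ p q r : k, μ y z = p • x + q • y + r • z ∧
      Y * Z + Z * Y = (2 : k) • (p • X + q • Y + r • Z)) :
    IsSpecialProduct μ := by
  have : FiniteDimensional k V := Module.finite_of_finrank_eq_succ hV
  let b := basisOfLinearIndependentOfCardEqFinrank h (by simp [hV])
  let σ : V →ₗ[k] B := b.constr k ![X, Y, Z]
  have hX : σ x = X := by simpa [b, σ] using b.constr_basis k ![X, Y, Z] 0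
  have hY : σ y = Y := by simpa [b, σ] using b.constr_basis k ![X, Y, Z] 1
  have hZ : σ z = Z := by simpa [b, σ] using b.constr_basis k ![X, Y, Z] 2
  have key : ∀ {v w : V} {S T : B}, (∃ p q r : k, μ v w = p • x + q • y + r • z ∧
      S * T + T * S = (2 : k) • (p • X + q • Y + r • Z)) →
      (2 : k) • σ (μ v w) = S * T + T * S := by
    rintro v w S T ⟨p, q, r, h1, h2⟩
    rw [h1, h2]
    simp only [map_add, map_smul, hX, hY, hZ]
  refine ⟨B, inferInstance, inferInstance, inferInstance, inferInstance, σ, ?_, fun v w => ?_⟩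
  · rw [injective_iff_map_eq_zero]
    intro v hv
    obtain ⟨p, q, r, rfl⟩ := exists_coords_of_linearIndependent hV h v
    simp only [map_add, map_smul, hX, hY, hZ] at hv
    obtain ⟨rfl, rfl, rfl⟩ := hinj p q r hv
    simp
  · obtain ⟨p, q, r, rfl⟩ := exists_coords_of_linearIndependent hV h v
    obtain ⟨p', q', r', rfl⟩ := exists_coords_of_linearIndependent hV h w
    have h1 := key hxx
    have h2 := key hyy
    have h3 := key hzz
    have h4 := key hxy
    have h5 := key hxz
    have h6 := key hyz
    simp only [map_add, map_smul, LinearMap.add_apply, LinearMap.smul_apply, hX, hY, hZ,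
      hcomm y x, hcomm z x, hcomm z y, add_mul, mul_add, smul_mul_assoc, mul_smul_comm]
    linear_combination (norm := module) (p * p') • h1 + (q * q') • h2 + (r * r') • h3
      + (p * q' + q * p') • h4 + (p * r' + r * p') • h5 + (q * r' + r * q') • h6

end Basis

section Peirce

/-- If `T (2T - 1) (T - 1)` kills `v`, then `v` is the sum of the eigenvectors `(2T² - T) v`,
`4 (T - T²) v` and `(1 - 3T + 2T²) v`, so one of them lies outside any subspace that does not
contain `v`. -/
theorem exists_eigenvector_notMem (h2 : (2 : k) ≠ 0) (T : V →ₗ[k] V) {U W : Submodule k V}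
    (hU : ∀ u ∈ U, T u ∈ U) {v : V} (hvU : v ∈ U) (hvW : v ∉ W)
    (hT : (3 : k) • T (T v) = T v + (2 : k) • T (T (T v))) :
    ∃ f ∈ U, f ∉ W ∧ ∃ c : k, T f = c • f ∧ (c = 0 ∨ 2 * c = 1 ∨ c = 1) := by
  have h1 := hU v hvU
  have h3 := hU _ h1
  by_contra! H
  refine hvW ?_
  have hP1 : (2 : k) • T (T v) - T v ∈ W := by
    by_contra hW
    refine (H _ (U.sub_mem (U.smul_mem _ h3) h1) hW 1 ?_).2.2 rfl
    simp only [map_sub, map_smul]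
    linear_combination (norm := module) -hT
  have hP2 : (4 : k) • T v - (4 : k) • T (T v) ∈ W := by
    by_contra hW
    refine (H _ (U.sub_mem (U.smul_mem _ h1) (U.smul_mem _ h3)) hW 2⁻¹ ?_).2.1 (mul_inv_cancel₀ h2)
    simp only [map_sub, map_smul]
    apply smul_right_injective V h2
    simp only [smul_sub, smul_smul, mul_inv_cancel_left₀ h2]
    linear_combination (norm := module) (4 : k) • hT
  have hP0 : v - (3 : k) • T v + (2 : k) • T (T v) ∈ W := by
    by_contra hW
    refine (H _ (U.add_mem (U.sub_mem hvU (U.smul_mem _ h1)) (U.smul_mem _ h3)) hW 0 ?_).1 rfl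
    simp only [map_sub, map_add, map_smul]
    linear_combination (norm := module) -hT
  convert W.add_mem (W.add_mem hP1 hP2) hP0 using 1
  module

variable {μ : V →ₗ[k] V →ₗ[k] V} {e u v : V}

/-- Left multiplication by an idempotent is a root of `2T³ - 3T² + T`. -/
theorem IsJordanProduct.idempotent_cubic (hJ : IsJordanProduct μ) (he : μ e e = e) (v : V) :
    (3 : k) • μ e (μ e v) = μ e v + (2 : k) • μ e (μ e (μ e v)) := by
  have h := hJ.linearized e e e v
  rw [he, hJ.comm (μ e v) e, he, hJ.comm (μ e (μ e v)) e] at h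
  linear_combination (norm := module) h

/-- Multiplication by an element of the Peirce component of eigenvalue `0` or `1` preserves each
Peirce component. -/
theorem IsJordanProduct.peirce_mul (hJ : IsJordanProduct μ) (he : μ e e = e) {s t : k}
    (hu : μ e u = s • u) (hv : μ e v = t • v) (ht : 1 - 2 * t ≠ 0) :
    μ e (μ u v) = s • μ u v := by
  have h := hJ.linearized e e u v
  simp only [he, hu, hv, map_smul, LinearMap.smul_apply] at h
  rw [hJ.comm v u, hJ.comm _ e] at h
  apply smul_right_injective V ht
  linear_combination (norm := module) h

/-- The product of two elements of the Peirce component of eigenvalue `½` has no component there.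
-/
theorem IsJordanProduct.peirce_half_mul (hJ : IsJordanProduct μ) (he : μ e e = e) {t : k}
    (hu : μ e u = t • u) (hv : μ e v = t • v) :
    μ e (μ e (μ u v)) = μ e (μ u v) := by
  have h := hJ.linearized u v e e
  rw [he, hJ.comm u e, hJ.comm v e] at h
  simp only [hu, hv, map_smul, LinearMap.smul_apply] at h
  rw [hJ.comm (μ u v) e, hJ.comm (μ e _) e, hJ.comm u e, hJ.comm v e, hu, hv] at h
  simp only [map_smul, LinearMap.smul_apply, hJ.comm v u] at h
  linear_combination (norm := module) -h

end Peirce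

section HalfEigenvector

variable {μ : V →ₗ[k] V →ₗ[k] V} {e n f : V} {t : k}

theorem LinearIndependent.eq_zero_of_triple {x y z : V} (h : LinearIndependent k ![x, y, z])
    {p q r : k} (h0 : p • x + q • y + r • z = 0) : p = 0 ∧ q = 0 ∧ r = 0 := by
  have := Fintype.linearIndependent_iff.1 h ![p, q, r] (by simpa [Fin.sum_univ_three] using h0)
  exact ⟨this 0, this 1, this 2⟩

theorem ne_zero_of_two_mul_eq_one (ht : 2 * t = 1) : t ≠ 0 := by
  rintro rfl
  simp at ht

theorem linearIndependent_of_half (he : μ e e = e) (ht : 2 * t = 1)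
    (hn : μ e n = t • n) (hn0 : n ≠ 0) : LinearIndependent k ![e, n] := by
  rw [LinearIndependent.pair_iff]
  intro p q h
  have ht0 := ne_zero_of_two_mul_eq_one ht
  have h1 := congrArg (μ e) h
  simp only [map_add, map_smul, he, hn, map_zero] at h1
  have h3 : (q * t) • n = 0 := by
    linear_combination (norm := module) h - h1 + ht • (q • n)
  have hq : q = 0 := by
    have := (smul_eq_zero.1 h3).resolve_right hn0
    exact (mul_eq_zero.1 this).resolve_right ht0
  subst hq
  refine ⟨?_, rfl⟩
  rw [zero_smul, add_zero] at h
  refine (smul_eq_zero.1 h).resolve_right ?_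
  rintro rfl
  rw [map_zero, LinearMap.zero_apply] at hn
  exact (smul_ne_zero ht0 hn0) hn.symm

set_option maxHeartbeats 800000 in
/-- Here `e² = e`, `en = ½n` and `ef = 0`. The Peirce rules leave `f² = γf`, `nf = qn` and
`n² = βf + αe`; the Jordan identities then force `β (γ - 2q) = 0`, `α = 2βq` and `q (2q - γ) = 0`.
Each of the remaining cases has a model in `3 × 3` matrices. -/
theorem isSpecialProduct_of_half_of_zero (hJ : IsJordanProduct μ)
    (hV : Module.finrank k V = 3) (he : μ e e = e) (ht : 2 * t = 1) (hn : μ e n = t • n)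
    (hf : μ e f = 0) (hli : LinearIndependent k ![f, e, n]) : IsSpecialProduct μ := by
  have ht0 := ne_zero_of_two_mul_eq_one ht
  have hf0 : μ e f = (0 : k) • f := by rw [hf, zero_smul]
  have hne : μ n e = t • n := by rw [hJ.comm, hn]
  have hfe : μ f e = 0 := by rw [hJ.comm, hf]
  obtain ⟨γ, hff⟩ : ∃ γ : k, μ f f = γ • f := by
    have h := hJ.peirce_mul he hf0 hf0 (by simp)
    obtain ⟨p, q, r, h1⟩ := exists_coords_of_linearIndependent hV hli (μ f f)
    simp only [h1, map_add, map_smul, hf, he, hn, zero_smul] at h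
    obtain ⟨-, hq, hr⟩ := hli.eq_zero_of_triple (p := 0) (q := q) (r := r * t)
      (by linear_combination (norm := module) h)
    refine ⟨p, ?_⟩
    rw [h1, hq, (mul_eq_zero.1 hr).resolve_right ht0]
    module
  obtain ⟨q, hnf⟩ : ∃ q : k, μ n f = q • n := by
    have h := hJ.peirce_mul he hn hf0 (by simp)
    obtain ⟨p, q, r, h1⟩ := exists_coords_of_linearIndependent hV hli (μ n f)
    simp only [h1, map_add, map_smul, hf, he, hn, smul_zero, map_zero] at h
    obtain ⟨hp, hq, -⟩ := hli.eq_zero_of_triple (p := t * p) (q := -(t * q)) (r := 0)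
      (by linear_combination (norm := module) -h - ht • (q • e))
    refine ⟨r, ?_⟩
    rw [h1, (mul_eq_zero.1 hp).resolve_left ht0,
      (mul_eq_zero.1 (neg_eq_zero.1 hq)).resolve_left ht0]
    module
  have hfn : μ f n = q • n := by rw [hJ.comm, hnf]
  obtain ⟨β, α, hnn⟩ : ∃ β α : k, μ n n = β • f + α • e := by
    have h := hJ.peirce_half_mul he hn hn
    obtain ⟨p, q, r, h1⟩ := exists_coords_of_linearIndependent hV hli (μ n n)
    simp only [h1, map_add, map_smul, hf, he, hn, smul_zero, map_zero] at h
    obtain ⟨-, -, hr⟩ := hli.eq_zero_of_triple (p := 0) (q := 0) (r := r * t)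
      (by linear_combination (norm := module) -(2 : k) • h + ht • ((r * t) • n))
    refine ⟨p, q, ?_⟩
    rw [h1, (mul_eq_zero.1 hr).resolve_right ht0]
    module
  have R1 : β * (γ - 2 * q) = 0 := by
    have h := hJ.linearized n e n f
    simp only [he, hf, hfe, hn, hne, hff, hfn, hnf, hnn, map_add, map_smul, map_zero,
      LinearMap.add_apply, LinearMap.smul_apply, LinearMap.zero_apply] at h
    obtain ⟨h1, -, -⟩ := hli.eq_zero_of_triple (p := t * (β * (γ - 2 * q))) (q := 0) (r := 0)
      (by linear_combination (norm := module) -h + ht • ((q * α) • e))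
    exact (mul_eq_zero.1 h1).resolve_left ht0
  have R2 : α = 2 * β * q := by
    have h := hJ.jordan n e
    simp only [he, hf, hfe, hn, hne, hff, hfn, hnf, hnn, map_add, map_smul, map_zero,
      LinearMap.add_apply, LinearMap.smul_apply, LinearMap.zero_apply, smul_zero, zero_add] at h
    obtain ⟨-, -, h1⟩ := hli.eq_zero_of_triple (p := 0) (q := 0) (r := t * (α - 2 * β * q))
      (by linear_combination (norm := module) -(2 : k) • h + ht • ((t * α) • n))
    exact sub_eq_zero.1 ((mul_eq_zero.1 h1).resolve_left ht0)
  have R3 : q * (2 * q - γ) = 0 := by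
    have h := hJ.linearized f n f e
    simp only [he, hf, hfe, hn, hne, hff, hfn, hnf, hnn, map_add, map_smul, map_zero,
      LinearMap.add_apply, LinearMap.smul_apply, LinearMap.zero_apply] at h
    obtain ⟨-, -, h1⟩ := hli.eq_zero_of_triple (p := 0) (q := 0) (r := t * (q * (2 * q - γ)))
      (by linear_combination (norm := module) -h)
    exact (mul_eq_zero.1 h1).resolve_left ht0
  by_cases hq : q = 0
  · subst hq
    obtain rfl : α = 0 := by simpa using R2
    by_cases hγ : γ = 0
    · subst hγ
      refine isSpecialProduct_of_triple hJ.comm hV hli (B := Matrix (Fin 3) (Fin 3) k)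
        !![0, 0, 1; 0, 0, 0; 0, 0, 0] !![0, 0, 0; 0, 1, 0; 0, 0, 0]
        !![0, 1, 0; 0, 0, β; 0, 0, 0] ?_ ⟨0, 0, 0, ?_⟩ ⟨0, 1, 0, ?_⟩ ⟨β, 0, 0, ?_⟩ ⟨0, 0, 0, ?_⟩
        ⟨0, 0, 0, ?_⟩ ⟨0, 0, t, ?_⟩
      · intro p q r h
        refine ⟨?_, ?_, ?_⟩
        · simpa using congrFun (congrFun h 0) 2
        · simpa using congrFun (congrFun h 1) 1
        · simpa using congrFun (congrFun h 0) 1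
      all_goals
        refine ⟨by simp [he, hf, hfe, hn, hff, hfn, hnn], ?_⟩
        simp only [smul_add, smul_smul, ht, mul_zero, zero_smul, one_smul]
        ext i j
        fin_cases i <;> fin_cases j <;> simp [Matrix.mul_apply, Fin.sum_univ_three] <;> ring
    · obtain rfl : β = 0 := by simpa [hγ] using R1
      refine isSpecialProduct_of_triple hJ.comm hV hli (B := Matrix (Fin 3) (Fin 3) k)
        !![0, 0, 0; 0, 0, 0; 0, 0, γ] !![1, 0, 0; 0, 0, 0; 0, 0, 0]
        !![0, 1, 0; 0, 0, 0; 0, 0, 0] ?_ ⟨γ, 0, 0, ?_⟩ ⟨0, 1, 0, ?_⟩ ⟨0, 0, 0, ?_⟩ ⟨0, 0, 0, ?_⟩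
        ⟨0, 0, 0, ?_⟩ ⟨0, 0, t, ?_⟩
      · intro p q r h
        refine ⟨?_, ?_, ?_⟩
        · simpa [hγ] using congrFun (congrFun h 2) 2
        · simpa using congrFun (congrFun h 0) 0
        · simpa using congrFun (congrFun h 0) 1
      all_goals
        refine ⟨by simp [he, hf, hfe, hn, hff, hfn, hnn], ?_⟩
        simp only [smul_add, smul_smul, ht, mul_zero, zero_smul, one_smul]
        ext i j
        fin_cases i <;> fin_cases j <;> simp [Matrix.mul_apply, Fin.sum_univ_three] <;> ring
  · obtain rfl : γ = 2 * q := (sub_eq_zero.1 ((mul_eq_zero.1 R3).resolve_left hq)).symm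
    have h2 : (2 : k) ≠ 0 := by
      rintro h
      rw [h, zero_mul] at ht
      exact zero_ne_one ht
    subst R2
    refine isSpecialProduct_of_triple hJ.comm hV hli (B := Matrix (Fin 3) (Fin 3) k)
      !![0, 0, 0; 0, 2 * q, 0; 0, 0, 0] !![1, 0, 0; 0, 0, 0; 0, 0, 0]
      !![0, 1, 0; 2 * β * q, 0, 0; 0, 0, 0] ?_ ⟨2 * q, 0, 0, ?_⟩ ⟨0, 1, 0, ?_⟩ ⟨β, 2 * β * q, 0, ?_⟩
      ⟨0, 0, 0, ?_⟩ ⟨0, 0, q, ?_⟩ ⟨0, 0, t, ?_⟩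
    · intro p q' r h
      refine ⟨?_, ?_, ?_⟩
      · simpa [hq, h2] using congrFun (congrFun h 1) 1
      · simpa using congrFun (congrFun h 0) 0
      · simpa using congrFun (congrFun h 0) 1
    all_goals
      refine ⟨by simp [he, hf, hfe, hn, hff, hfn, hnn], ?_⟩
      simp only [smul_add, smul_smul, ht, mul_zero, zero_smul, one_smul]
      ext i j
      fin_cases i <;> fin_cases j <;> simp [Matrix.mul_apply, Fin.sum_univ_three] <;> ring

/-- Here `e² = e`, `en = ½n`, `ef = f` and `fn = 0`. The identities leave `f² = γf` and `n² = βf`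
with `βγ² = 0`. -/
theorem isSpecialProduct_of_half_of_one (hJ : IsJordanProduct μ)
    (hV : Module.finrank k V = 3) (he : μ e e = e) (ht : 2 * t = 1) (hn : μ e n = t • n)
    (hf : μ e f = f) (hfn : μ f n = 0) (hli : LinearIndependent k ![f, e, n]) :
    IsSpecialProduct μ := by
  have ht0 := ne_zero_of_two_mul_eq_one ht
  have hf1 : μ e f = (1 : k) • f := by rw [hf, one_smul]
  have hne : μ n e = t • n := by rw [hJ.comm, hn]
  have hfe : μ f e = f := by rw [hJ.comm, hf]
  have hnf : μ n f = 0 := by rw [hJ.comm, hfn]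
  obtain ⟨γ, δ, hff⟩ : ∃ γ δ : k, μ f f = γ • f + δ • e := by
    have h := hJ.peirce_mul he hf1 hf1 (by norm_num)
    obtain ⟨p, q, r, h1⟩ := exists_coords_of_linearIndependent hV hli (μ f f)
    simp only [h1, map_add, map_smul, hf, he, hn, one_smul] at h
    obtain ⟨-, -, hr⟩ := hli.eq_zero_of_triple (p := 0) (q := 0) (r := r * t)
      (by linear_combination (norm := module) -h + ht • (r • n))
    refine ⟨p, q, ?_⟩
    rw [h1, (mul_eq_zero.1 hr).resolve_right ht0]
    module
  obtain ⟨β, α, hnn⟩ : ∃ β α : k, μ n n = β • f + α • e := by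
    have h := hJ.peirce_half_mul he hn hn
    obtain ⟨p, q, r, h1⟩ := exists_coords_of_linearIndependent hV hli (μ n n)
    simp only [h1, map_add, map_smul, hf, he, hn] at h
    obtain ⟨-, -, hr⟩ := hli.eq_zero_of_triple (p := 0) (q := 0) (r := r * t)
      (by linear_combination (norm := module) -(2 : k) • h + ht • ((r * t) • n))
    refine ⟨p, q, ?_⟩
    rw [h1, (mul_eq_zero.1 hr).resolve_right ht0]
    module
  obtain rfl : α = 0 := by
    have h := hJ.jordan n e
    simp only [he, hf, hfe, hn, hne, hff, hfn, hnf, hnn, map_add, map_smul, map_zero,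
      LinearMap.add_apply, LinearMap.smul_apply, LinearMap.zero_apply, smul_zero, zero_add] at h
    obtain ⟨-, -, h1⟩ := hli.eq_zero_of_triple (p := 0) (q := 0) (r := t * α)
      (by linear_combination (norm := module) -(2 : k) • h + ht • ((t * α) • n))
    exact (mul_eq_zero.1 h1).resolve_left ht0
  obtain rfl : δ = 0 := by
    have h := hJ.linearized f f e n
    simp only [he, hf, hfe, hn, hne, hff, hfn, hnf, hnn, map_add, map_smul, map_zero,
      LinearMap.add_apply, LinearMap.smul_apply, LinearMap.zero_apply, smul_zero, zero_add] at h
    obtain ⟨-, -, h1⟩ := hli.eq_zero_of_triple (p := 0) (q := 0) (r := t * δ)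
      (by linear_combination (norm := module) -(2 : k) • h + ht • ((t * δ) • n))
    exact (mul_eq_zero.1 h1).resolve_left ht0
  have R : β * γ ^ 2 = 0 := by
    have h := hJ.linearized f f n n
    simp only [he, hf, hfe, hn, hne, hff, hfn, hnf, hnn, map_add, map_smul, map_zero,
      LinearMap.add_apply, LinearMap.smul_apply, LinearMap.zero_apply, smul_zero, zero_add] at h
    obtain ⟨h1, -, -⟩ := hli.eq_zero_of_triple (p := β * γ ^ 2) (q := 0) (r := 0)
      (by linear_combination (norm := module) h)
    exact h1
  by_cases hγ : γ = 0
  · subst hγ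
    refine isSpecialProduct_of_triple hJ.comm hV hli (B := Matrix (Fin 3) (Fin 3) k)
      !![0, 0, 1; 0, 0, 0; 0, 0, 0] !![1, 0, 0; 0, 0, 0; 0, 0, 1]
      !![0, 1, 0; 0, 0, β; 0, 0, 0] ?_ ⟨0, 0, 0, ?_⟩ ⟨0, 1, 0, ?_⟩ ⟨β, 0, 0, ?_⟩ ⟨1, 0, 0, ?_⟩
      ⟨0, 0, 0, ?_⟩ ⟨0, 0, t, ?_⟩
    · intro p q r h
      refine ⟨?_, ?_, ?_⟩
      · simpa using congrFun (congrFun h 0) 2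
      · simpa using congrFun (congrFun h 0) 0
      · simpa using congrFun (congrFun h 0) 1
    all_goals
      refine ⟨by simp [he, hf, hfe, hn, hff, hfn, hnn], ?_⟩
      simp only [smul_add, smul_smul, ht, mul_zero, zero_smul, one_smul]
      ext i j
      fin_cases i <;> fin_cases j <;> simp [Matrix.mul_apply, Fin.sum_univ_three] <;> ring
  · obtain rfl : β = 0 := by simpa [hγ] using R
    refine isSpecialProduct_of_triple hJ.comm hV hli (B := Matrix (Fin 3) (Fin 3) k)
      !![0, 0, 0; 0, 0, 0; 0, 0, γ] !![1, 0, 0; 0, 0, 0; 0, 0, 1]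
      !![0, 1, 0; 0, 0, 0; 0, 0, 0] ?_ ⟨γ, 0, 0, ?_⟩ ⟨0, 1, 0, ?_⟩ ⟨0, 0, 0, ?_⟩ ⟨1, 0, 0, ?_⟩
      ⟨0, 0, 0, ?_⟩ ⟨0, 0, t, ?_⟩
    · intro p q r h
      refine ⟨?_, ?_, ?_⟩
      · have hq : q = 0 := by simpa using congrFun (congrFun h 0) 0
        simpa [hγ, hq] using congrFun (congrFun h 2) 2
      · simpa using congrFun (congrFun h 0) 0
      · simpa using congrFun (congrFun h 0) 1
    all_goals
      refine ⟨by simp [he, hf, hfe, hn, hff, hfn, hnn], ?_⟩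
      simp only [smul_add, smul_smul, ht, mul_zero, zero_smul, one_smul]
      ext i j
      fin_cases i <;> fin_cases j <;> simp [Matrix.mul_apply, Fin.sum_univ_three] <;> ring

/-- Here `e² = e` and `n`, `f` both have Peirce eigenvalue `½`. All products of `n` and `f` vanish.
-/
theorem isSpecialProduct_of_half_of_half (hJ : IsJordanProduct μ)
    (hV : Module.finrank k V = 3) (he : μ e e = e) (ht : 2 * t = 1) (hn : μ e n = t • n)
    (hf : μ e f = t • f) (hli : LinearIndependent k ![f, e, n]) :
    IsSpecialProduct μ := by
  have ht0 := ne_zero_of_two_mul_eq_one ht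
  have hprod : ∀ u v, μ e u = t • u → μ e v = t • v → ∃ α : k, μ u v = α • e := by
    intro u v hu hv
    have h := hJ.peirce_half_mul he hu hv
    obtain ⟨p, q, r, h1⟩ := exists_coords_of_linearIndependent hV hli (μ u v)
    simp only [h1, map_add, map_smul, hf, he, hn] at h
    obtain ⟨hp, -, hr⟩ := hli.eq_zero_of_triple (p := p * t) (q := 0) (r := r * t)
      (by linear_combination (norm := module) -(2 : k) • h + ht • ((r * t) • n + (p * t) • f))
    refine ⟨q, ?_⟩
    rw [h1, (mul_eq_zero.1 hp).resolve_right ht0, (mul_eq_zero.1 hr).resolve_right ht0]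
    module
  have hsq : ∀ u, μ e u = t • u → u ≠ 0 → μ u u = 0 := by
    intro u hu hu0
    obtain ⟨α, hα⟩ := hprod u u hu hu
    have h := hJ.jordan u e
    simp only [hα, he, hu, map_smul, LinearMap.smul_apply] at h
    have h1 : (α * t) • u = 0 := by
      linear_combination (norm := module) -(2 : k) • h + ht • ((t * α) • u)
    rw [hα, (mul_eq_zero.1 ((smul_eq_zero.1 h1).resolve_right hu0)).resolve_right ht0, zero_smul]
  have hnn := hsq n hn (hli.ne_zero 2)
  have hff := hsq f hf (hli.ne_zero 0)
  have hfn : μ f n = 0 := by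
    have h := hsq (f + n) (by rw [map_add, hf, hn, smul_add]) (fun h0 => by
      have := (hli.eq_zero_of_triple (p := 1) (q := 0) (r := 1) (by
        rw [one_smul, one_smul, zero_smul, add_zero, h0])).1
      exact one_ne_zero this)
    simp only [map_add, LinearMap.add_apply, hnn, hff, hJ.comm n f] at h
    linear_combination (norm := module) t • h - ht • μ f n
  have hfe : μ f e = t • f := by rw [hJ.comm, hf]
  refine isSpecialProduct_of_triple hJ.comm hV hli (B := Matrix (Fin 3) (Fin 3) k)
    !![0, 0, 1; 0, 0, 0; 0, 0, 0] !![1, 0, 0; 0, 0, 0; 0, 0, 0]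
    !![0, 1, 0; 0, 0, 0; 0, 0, 0] ?_ ⟨0, 0, 0, ?_⟩ ⟨0, 1, 0, ?_⟩ ⟨0, 0, 0, ?_⟩ ⟨t, 0, 0, ?_⟩
    ⟨0, 0, 0, ?_⟩ ⟨0, 0, t, ?_⟩
  · intro p q r h
    refine ⟨?_, ?_, ?_⟩
    · simpa using congrFun (congrFun h 0) 2
    · simpa using congrFun (congrFun h 0) 0
    · simpa using congrFun (congrFun h 0) 1
  all_goals
    refine ⟨by simp [he, hf, hfe, hn, hff, hfn, hnn], ?_⟩
    simp only [smul_add, smul_smul, ht, mul_zero, zero_smul, one_smul]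
    ext i j
    fin_cases i <;> fin_cases j <;> simp [Matrix.mul_apply, Fin.sum_univ_three] <;> ring

/-- A three-dimensional Jordan algebra with an idempotent that has a nonzero Peirce component of
eigenvalue `½` is special. -/
theorem isSpecialProduct_of_half (hJ : IsJordanProduct μ)
    (hV : Module.finrank k V = 3) (he : μ e e = e) (ht : 2 * t = 1) (hn : μ e n = t • n)
    (hn0 : n ≠ 0) : IsSpecialProduct μ := by
  have h2 : (2 : k) ≠ 0 := by
    rintro h
    rw [h, zero_mul] at ht
    exact zero_ne_one ht
  have hen := linearIndependent_of_half he ht hn hn0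
  obtain ⟨g, hg⟩ := exists_notMem_span_pair hV e n
  obtain ⟨f, -, hfW, c, hfc, hc⟩ := exists_eigenvector_notMem h2 (μ e) (U := ⊤)
    (fun _ _ => trivial) trivial hg (hJ.idempotent_cubic he g)
  have hli := linearIndependent_triple_of_notMem hen hfW
  obtain rfl | hc | rfl := hc
  · exact isSpecialProduct_of_half_of_zero hJ hV he ht hn (by rw [hfc, zero_smul]) hli
  · obtain rfl : c = t := mul_left_cancel₀ h2 (hc.trans ht.symm)
    exact isSpecialProduct_of_half_of_half hJ hV he ht hn hfc hli
  · have ht0 := ne_zero_of_two_mul_eq_one ht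
    obtain ⟨q, hnf⟩ : ∃ q : k, μ n f = q • n := by
      have h := hJ.peirce_mul he hn hfc (by norm_num)
      obtain ⟨p, q, r, h1⟩ := exists_coords_of_linearIndependent hV hli (μ n f)
      simp only [h1, map_add, map_smul, hfc, he, hn, one_smul] at h
      obtain ⟨hp, hq, -⟩ := hli.eq_zero_of_triple (p := t * p) (q := t * q) (r := 0)
        (by linear_combination (norm := module) h + ht • (q • e + p • f))
      refine ⟨r, ?_⟩
      rw [h1, (mul_eq_zero.1 hp).resolve_left ht0, (mul_eq_zero.1 hq).resolve_left ht0]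
      module
    -- Subtracting a multiple of `e` from `f` makes it annihilate `n`.
    refine isSpecialProduct_of_half_of_one (f := f - (2 * q) • e) hJ hV he ht hn ?_ ?_
      (linearIndependent_triple_of_notMem hen ?_)
    · rw [map_sub, map_smul, hfc, he, one_smul]
    · rw [map_sub, map_smul, LinearMap.sub_apply, LinearMap.smul_apply, hJ.comm f n, hnf, hn]
      linear_combination (norm := module) -ht • (q • n)
    · intro h
      refine hfW ?_
      rw [← sub_add_cancel f ((2 * q) • e)]
      exact add_mem h (Submodule.smul_mem _ _ (Submodule.subset_span (by simp)))

end HalfEigenvector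

/-! ### Jordan algebras of dimension at most three are special -/

section Associative

variable {μ : V →ₗ[k] V →ₗ[k] V} {e f x y z : V}

/-- A commutative algebra is associative as soon as the multiplications by spanning elements
commute. -/
theorem assoc_of_commute_of_span (hcomm : ∀ a b, μ a b = μ b a)
    (hspan : ∀ v, ∃ p q r : k, v = p • x + q • y + r • z)
    (hxy : ∀ v, μ x (μ y v) = μ y (μ x v)) (hxz : ∀ v, μ x (μ z v) = μ z (μ x v))
    (hyz : ∀ v, μ y (μ z v) = μ z (μ y v)) (a b c : V) : μ (μ a b) c = μ a (μ b c) := by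
  have hxy' : Commute (μ x : Module.End k V) (μ y) := LinearMap.ext hxy
  have hxz' : Commute (μ x : Module.End k V) (μ z) := LinearMap.ext hxz
  have hyz' : Commute (μ y : Module.End k V) (μ z) := LinearMap.ext hyz
  have key : ∀ a b : V, Commute (μ a : Module.End k V) (μ b) := by
    have h1 : ∀ (a : V) (T : Module.End k V), Commute (μ x : Module.End k V) T →
        Commute (μ y : Module.End k V) T → Commute (μ z : Module.End k V) T →
        Commute (μ a : Module.End k V) T := by
      intro a T hx hy hz
      obtain ⟨p, q, r, rfl⟩ := hspan a
      simp only [map_add, map_smul]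
      exact ((hx.smul_left p).add_left (hy.smul_left q)).add_left (hz.smul_left r)
    intro a b
    exact h1 a _ (h1 b _ (.refl _) hxy'.symm hxz'.symm).symm
      (h1 b _ hxy' (.refl _) hyz'.symm).symm (h1 b _ hxz' hyz' (.refl _)).symm
  rw [hcomm (μ a b) c, hcomm b c]
  exact LinearMap.congr_fun (key c a) b

theorem IsJordanProduct.commute_sq (hJ : IsJordanProduct μ) (a v : V) :
    μ a (μ (μ a a) v) = μ (μ a a) (μ a v) := by
  rw [hJ.comm a (μ _ v), ← hJ.jordan, hJ.comm v a]

/-- Multiplication by `a³` is a polynomial in the multiplications by `a` and by `a²`. -/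
theorem IsJordanProduct.mul_cube (hJ : IsJordanProduct μ) (a v : V) :
    μ (μ (μ a a) a) v = (3 : k) • μ (μ a a) (μ a v) - (2 : k) • μ a (μ a (μ a v)) := by
  have h := hJ.linearized a a a v
  rw [hJ.comm (μ a v) (μ a a), hJ.comm (μ a v) a, hJ.comm (μ a (μ a v)) a] at h
  linear_combination (norm := module) -h

/-- A Jordan algebra spanned by `a`, `a²` and `a³` is associative. -/
theorem IsJordanProduct.assoc_of_powers_span (hJ : IsJordanProduct μ) {a : V}
    (hspan : ∀ v, ∃ p q r : k, v = p • a + q • μ a a + r • μ (μ a a) a) (b c d : V) :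
    μ (μ b c) d = μ b (μ c d) := by
  have h1 := hJ.commute_sq a
  refine assoc_of_commute_of_span hJ.comm hspan h1 (fun v => ?_) (fun v => ?_) b c d <;>
    simp only [hJ.mul_cube, map_sub, map_smul, h1]

/-- If no idempotent has a Peirce component of eigenvalue `½`, multiplication by an idempotent
commutes with all multiplications. -/
theorem IsJordanProduct.idempotent_central (hJ : IsJordanProduct μ) (h2 : (2 : k) ≠ 0)
    (H : ∀ e n, μ e e = e → μ e n = (2⁻¹ : k) • n → n = 0) (he : μ e e = e) (u v : V) :
    μ e (μ u v) = μ u (μ e v) := by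
  have hidem : ∀ w, μ e (μ e w) = μ e w := by
    intro w
    have hw := hJ.idempotent_cubic he w
    have h0 : μ e w - μ e (μ e w) = 0 := by
      apply H e _ he
      apply smul_right_injective V h2
      simp only [map_sub, smul_smul, mul_inv_cancel₀ h2, one_smul]
      linear_combination (norm := module) hw
    exact (sub_eq_zero.1 h0).symm
  have key : ∀ u (s : k), μ e u = s • u → 1 - 2 * s ≠ 0 → μ e (μ u v) = μ u (μ e v) := by
    intro u s hu hs
    have h1 := hJ.peirce_mul he (u := μ e v) (s := 1) (by rw [hidem, one_smul]) hu hs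
    have h0 := hJ.peirce_mul he (u := v - μ e v) (s := 0)
      (by rw [map_sub, hidem, sub_self, zero_smul]) hu hs
    rw [hJ.comm _ u] at h0 h1
    rw [map_sub, map_sub, zero_smul, sub_eq_zero, h1, one_smul] at h0
    exact h0
  have h1 := key (μ e u) 1 (by rw [hidem, one_smul]) (by norm_num)
  have h0 := key (u - μ e u) 0 (by rw [map_sub, hidem, sub_self, zero_smul]) (by simp)
  rw [← sub_add_cancel u (μ e u)]
  simp only [map_add μ, LinearMap.add_apply, map_add (μ e), h1, h0]

theorem IsJordanProduct.assoc_of_idempotents (hJ : IsJordanProduct μ) (h2 : (2 : k) ≠ 0)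
    (H : ∀ e n, μ e e = e → μ e n = (2⁻¹ : k) • n → n = 0) (he : μ e e = e) (hf : μ f f = f)
    (hspan : ∀ v, ∃ p q r : k, v = p • z + q • e + r • f) (a b c : V) :
    μ (μ a b) c = μ a (μ b c) := by
  refine assoc_of_commute_of_span hJ.comm hspan ?_ ?_ ?_ a b c
  · exact fun v => (hJ.idempotent_central h2 H he _ _).symm
  · exact fun v => (hJ.idempotent_central h2 H hf _ _).symm
  · exact fun v => (hJ.idempotent_central h2 H he _ _)

theorem linearIndependent_pair_of_notMem (hx : x ≠ 0) (hy : y ∉ Submodule.span k {x}) :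
    LinearIndependent k ![x, y] := by
  rw [LinearIndependent.pair_iff' hx]
  intro a ha
  exact hy (Submodule.mem_span_singleton.2 ⟨a, ha⟩)

/-- The case of an idempotent `e`, unique up to scalars, that annihilates some `f ≠ 0`. -/
theorem IsJordanProduct.assoc_of_annihilator (hJ : IsJordanProduct μ) (h2 : (2 : k) ≠ 0)
    (hV : Module.finrank k V = 3)
    (H : ∀ e n, μ e e = e → μ e n = (2⁻¹ : k) • n → n = 0) (he : μ e e = e) (he0 : e ≠ 0)
    (huniq : ∀ f, μ f f = f → f ∈ Submodule.span k {e}) (hf : μ e f = 0) (hf0 : f ≠ 0)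
    (a b c : V) : μ (μ a b) c = μ a (μ b c) := by
  have hcen := fun u v => hJ.idempotent_central h2 H he u v
  have hef : LinearIndependent k ![e, f] := by
    refine linearIndependent_pair_of_notMem he0 fun h => hf0 ?_
    obtain ⟨c, rfl⟩ := Submodule.mem_span_singleton.1 h
    rwa [map_smul, he] at hf
  obtain ⟨g, hg⟩ := exists_notMem_span_pair hV e f
  have hg' : μ e g ∉ Submodule.span k {e, f} ∨ g - μ e g ∉ Submodule.span k {e, f} := by
    by_contra! h
    refine hg ?_
    rw [← sub_add_cancel g (μ e g)]
    exact add_mem h.2 h.1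
  have hidem : μ e (μ e g) = μ e g := by
    have h := hcen g e
    rwa [he, hJ.comm g e] at h
  obtain hg' | hg' := hg'
  · -- Elements of the two Peirce components have product zero, so their multiplications commute.
    have hortho : ∀ u v, μ e u = u → μ e v = 0 → μ u v = 0 := by
      intro u v hu hv
      have h := hcen v u
      rw [hu, hJ.comm v u, hcen u v, hv, map_zero] at h
      exact h.symm
    have hgf : ∀ v, μ (μ e g) (μ f v) = μ f (μ (μ e g) v) := by
      intro v
      rw [hortho (μ e g) (μ f v) hidem (by rw [hJ.comm f, hcen, hf, map_zero]), hJ.comm f,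
        hortho (μ (μ e g) v) f (by rw [hJ.comm _ v, hcen, hidem]) hf]
    exact assoc_of_commute_of_span hJ.comm
      (exists_coords_of_linearIndependent hV (linearIndependent_triple_of_notMem hef hg'))
      (fun v => (hcen _ _).symm) hgf (fun v => hcen _ _) a b c
  · generalize hh : g - μ e g = h at hg'
    have heh : μ e h = 0 := by rw [← hh, map_sub, hidem, sub_self]
    clear hh
    by_contra hna
    -- Every element of the annihilator of `e` squares to zero.
    have hsq : ∀ v, μ e v = 0 → μ v v = 0 := by
      intro v hv
      by_cases hli : LinearIndependent k ![e, v, μ v v]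
      · exact absurd (assoc_of_commute_of_span hJ.comm (exists_coords_of_linearIndependent hV hli)
          (fun w => hcen _ _) (fun w => hcen _ _) (hJ.commute_sq v) a b c) hna
      · obtain ⟨p, q, r, h0, hpqr⟩ := exists_relation_of_not_linearIndependent hli
        have h1 := congrArg (μ e) h0
        simp only [map_add, map_smul, he, hv, hcen, map_zero, smul_zero, add_zero] at h1
        obtain rfl : p = 0 := (smul_eq_zero.1 h1).resolve_right he0
        rw [zero_smul, zero_add] at h0
        by_cases hr : r = 0
        · subst hr
          have hq : q ≠ 0 := fun hq => hpqr ⟨rfl, hq, rfl⟩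
          rw [zero_smul, add_zero] at h0
          rw [(smul_eq_zero.1 h0).resolve_left hq, map_zero]
        · have hvv : μ v v = (-(r⁻¹ * q)) • v := by
            apply smul_right_injective V hr
            simp only [smul_smul, mul_neg, mul_inv_cancel_left₀ hr]
            linear_combination (norm := module) h0
          generalize -(r⁻¹ * q) = χ at hvv
          by_cases hχ : χ = 0
          · rw [hvv, hχ, zero_smul]
          · have hmem := huniq (χ⁻¹ • v) (by
              rw [map_smul, map_smul, LinearMap.smul_apply, hvv, inv_smul_smul₀ hχ])
            obtain ⟨s, hs⟩ := Submodule.mem_span_singleton.1 hmem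
            have h2 := congrArg (μ e) hs
            rw [map_smul, map_smul, he, hv, smul_zero, hs, smul_eq_zero] at h2
            rw [h2.resolve_left (inv_ne_zero hχ), map_zero]
    have hff := hsq f hf
    have hhh := hsq h heh
    have hfh : μ f h = 0 := by
      have h3 := hsq (f + h) (by rw [map_add, hf, heh, add_zero])
      simp only [map_add, LinearMap.add_apply, hff, hhh, hJ.comm h f] at h3
      refine (smul_eq_zero.1 (?_ : (2 : k) • μ f h = 0)).resolve_left h2
      linear_combination (norm := module) h3
    have hfe : μ f e = 0 := by rw [hJ.comm, hf]
    have hhe : μ h e = 0 := by rw [hJ.comm, heh]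
    have hhf : μ h f = 0 := by rw [hJ.comm, hfh]
    have hspan := exists_coords_of_linearIndependent hV
      (linearIndependent_triple_of_notMem hef hg')
    refine hna (assoc_of_commute_of_span hJ.comm hspan (fun v => (hcen _ _).symm) (fun v => ?_)
      (fun v => hcen _ _) a b c)
    obtain ⟨p, q, r, rfl⟩ := hspan v
    simp [hff, hhh, hfh, hfe, hhe, hhf]

/-- The case of a unit `e` that is the only idempotent up to scalars. If no `e, v, v²` form a
basis, every element is quadratic over `ke`, and shifting it by a multiple of `e` makes its square
zero. -/
theorem IsJordanProduct.assoc_of_unit [IsAlgClosed k] (hJ : IsJordanProduct μ) (h2 : (2 : k) ≠ 0)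
    (hV : Module.finrank k V = 3) (he : ∀ v, μ e v = v) (he0 : e ≠ 0)
    (huniq : ∀ f, μ f f = f → f ∈ Submodule.span k {e})
    (a b c : V) : μ (μ a b) c = μ a (μ b c) := by
  by_contra hna
  have he' : ∀ v, μ v e = v := fun v => by rw [hJ.comm, he]
  have hnil : ∀ v, v ∉ Submodule.span k {e} → ∃ s : k, μ (v - s • e) (v - s • e) = 0 := by
    intro v hv
    by_cases hli : LinearIndependent k ![e, v, μ v v]
    · exact absurd (assoc_of_commute_of_span hJ.comm (exists_coords_of_linearIndependent hV hli)
        (fun w => by rw [he, he]) (fun w => by rw [he, he]) (hJ.commute_sq v) a b c) hna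
    obtain ⟨p, q, r, h0, hpqr⟩ := exists_relation_of_not_linearIndependent hli
    have hr : r ≠ 0 := by
      rintro rfl
      have hev := linearIndependent_pair_of_notMem he0 hv
      obtain ⟨hp, hq⟩ := LinearIndependent.pair_iff.1 hev p q (by simpa using h0)
      exact hpqr ⟨hp, hq, rfl⟩
    obtain ⟨s, τ, hvv⟩ : ∃ s τ : k, μ v v = (2 * s) • v + (τ - s ^ 2) • e := by
      refine ⟨-(2⁻¹ * (r⁻¹ * q)), -(r⁻¹ * p) + (2⁻¹ * (r⁻¹ * q)) ^ 2, ?_⟩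
      apply smul_right_injective V hr
      rw [mul_neg, mul_inv_cancel_left₀ h2]
      simp only [smul_add, smul_smul, mul_neg, mul_inv_cancel_left₀ hr, neg_sq,
        add_sub_cancel_right]
      linear_combination (norm := module) h0
    have hsq : μ (v - s • e) (v - s • e) = τ • e := by
      simp only [map_sub, map_smul, LinearMap.sub_apply, LinearMap.smul_apply, he, he', hvv]
      module
    refine ⟨s, ?_⟩
    by_cases hτ : τ = 0
    · rw [hsq, hτ, zero_smul]
    -- Otherwise a square root of `τ` yields a further idempotent.
    obtain ⟨ρ, hρ⟩ := IsAlgClosed.exists_pow_nat_eq τ (n := 2) (by norm_num)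
    have hρ0 : ρ ≠ 0 := by
      rintro rfl
      exact hτ (by rw [← hρ]; simp)
    refine absurd (huniq ((2⁻¹ : k) • (e + ρ⁻¹ • (v - s • e))) ?_) ?_
    · generalize hw : v - s • e = w at hsq
      simp only [map_add, map_smul, LinearMap.add_apply, LinearMap.smul_apply, he, he', hsq,
        smul_smul]
      have h3 : ρ⁻¹ * (ρ⁻¹ * τ) = 1 := by rw [← hρ]; field_simp
      have h4 : (2 : k)⁻¹ * 2 = 1 := inv_mul_cancel₀ h2
      linear_combination (norm := module) h3 • (((2 : k)⁻¹ * (2 : k)⁻¹) • e)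
        + h4 • ((2 : k)⁻¹ • (e + ρ⁻¹ • w))
    · intro hmem
      refine hv ?_
      have h5 := Submodule.smul_mem _ ρ (Submodule.sub_mem _ (Submodule.smul_mem _ (2 : k) hmem)
        (Submodule.mem_span_singleton_self e))
      rw [smul_inv_smul₀ h2, add_sub_cancel_left, smul_inv_smul₀ hρ0] at h5
      rw [← sub_add_cancel v (s • e)]
      exact add_mem h5 (Submodule.smul_mem _ _ (Submodule.mem_span_singleton_self e))
  obtain ⟨x, hx⟩ : ∃ x, x ∉ Submodule.span k {e} := by
    obtain ⟨x, hx⟩ := exists_notMem_span_pair hV e e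
    exact ⟨x, by simpa using hx⟩
  obtain ⟨s, hxx⟩ := hnil x hx
  have hx' : x - s • e ∉ Submodule.span k {e} := fun h => hx (by
    rw [← sub_add_cancel x (s • e)]
    exact add_mem h (Submodule.smul_mem _ _ (Submodule.mem_span_singleton_self e)))
  generalize x - s • e = x at hxx hx'
  have hex := linearIndependent_pair_of_notMem he0 hx'
  obtain ⟨y, hy⟩ := exists_notMem_span_pair hV e x
  have hle : Submodule.span k {e} ≤ Submodule.span k {e, x} := Submodule.span_mono (by simp)
  have hemem : ∀ s : k, s • e ∈ Submodule.span k {e, x} := fun s =>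
    hle (Submodule.smul_mem _ _ (Submodule.mem_span_singleton_self e))
  have hxmem : x ∈ Submodule.span k {e, x} := Submodule.subset_span (by simp)
  obtain ⟨s', hyy⟩ := hnil y fun h => hy (hle h)
  have hy' : y - s' • e ∉ Submodule.span k {e, x} := fun h => hy (by
    rw [← sub_add_cancel y (s' • e)]
    exact add_mem h (hemem _))
  generalize y - s' • e = y at hyy hy'
  have hli := linearIndependent_triple_of_notMem hex hy'
  have hxy : μ x y = 0 := by
    obtain ⟨c, hc⟩ := hnil (y + x) fun h => hy' (by
      rw [← add_sub_cancel_right y x]; exact sub_mem (hle h) hxmem)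
    obtain ⟨d, hd⟩ := hnil (y - x) fun h => hy' (by
      rw [← sub_add_cancel y x]; exact add_mem (hle h) hxmem)
    simp only [map_sub, map_add, map_smul, LinearMap.sub_apply, LinearMap.add_apply,
      LinearMap.smul_apply, he, he', hxx, hyy, hJ.comm y x] at hc hd
    obtain ⟨h3, -, h4⟩ := hli.eq_zero_of_triple (p := -2 * (c + d)) (q := c ^ 2 + d ^ 2)
      (r := -2 * (c - d)) (by linear_combination (norm := module) hc + hd)
    have h5 : c = 0 := by
      have h6 : (2 : k) * (2 * c) = 0 := by linear_combination -h3 - h4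
      simpa [h2] using h6
    rw [h5] at hc
    refine (smul_eq_zero.1 (?_ : (2 : k) • μ x y = 0)).resolve_left h2
    linear_combination (norm := module) hc
  have hspan := exists_coords_of_linearIndependent hV hli
  refine hna (assoc_of_commute_of_span hJ.comm hspan (fun v => ?_) (fun v => ?_)
    (fun v => ?_) a b c)
  · simp only [he]
  · obtain ⟨p, q, r, rfl⟩ := hspan v
    simp [he', hxx, hyy, hxy, hJ.comm y x]
  · simp only [he]

theorem IsJordanProduct.assoc_of_idempotent [IsAlgClosed k] (hJ : IsJordanProduct μ)
    (h2 : (2 : k) ≠ 0) (hV : Module.finrank k V = 3)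
    (H : ∀ e n, μ e e = e → μ e n = (2⁻¹ : k) • n → n = 0) (he : μ e e = e) (he0 : e ≠ 0)
    (a b c : V) : μ (μ a b) c = μ a (μ b c) := by
  by_cases huniq : ∀ f, μ f f = f → f ∈ Submodule.span k {e}
  · by_cases hann : ∃ f, μ e f = 0 ∧ f ≠ 0
    · obtain ⟨f, hf, hf0⟩ := hann
      exact hJ.assoc_of_annihilator h2 hV H he he0 huniq hf hf0 a b c
    · push Not at hann
      refine hJ.assoc_of_unit h2 hV (fun v => ?_) he0 huniq a b c
      rw [← sub_eq_zero]
      apply hann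
      have h := hJ.idempotent_central h2 H he v e
      rw [he, hJ.comm v e] at h
      rw [map_sub, h, sub_self]
  · push Not at huniq
    obtain ⟨f, hf, hfe⟩ := huniq
    obtain ⟨g, hg⟩ := exists_notMem_span_pair hV e f
    exact hJ.assoc_of_idempotents h2 H he hf (exists_coords_of_linearIndependent hV
      (linearIndependent_triple_of_notMem (linearIndependent_pair_of_notMem he0 hfe) hg)) a b c

/-- In the absence of idempotents, an element whose first three powers are dependent has cube zero.
-/
theorem IsJordanProduct.cube_eq_zero (hJ : IsJordanProduct μ) (hidem : ∀ e, μ e e = e → e = 0)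
    {a : V} (hli : ¬ LinearIndependent k ![a, μ a a, μ (μ a a) a]) : μ (μ a a) a = 0 := by
  obtain ⟨p, q, r, h0, hpqr⟩ := exists_relation_of_not_linearIndependent hli
  have h4 : μ (μ a a) (μ a a) = μ a (μ a (μ a a)) := by
    rw [← hJ.commute_sq, hJ.comm (μ a a) a]
  rw [hJ.comm (μ a a) a] at h0 ⊢
  by_cases hp : p = 0
  · subst hp
    by_cases hq : q = 0
    · subst hq
      have hr : r ≠ 0 := fun hr => hpqr ⟨rfl, rfl, hr⟩
      simpa [hr] using h0
    · -- Here `a²` is a multiple of `a³`, hence of `a⁴`, and a multiple of `a²` is idempotent.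
      have ha : μ a a = (-(q⁻¹ * r)) • μ a (μ a a) := by
        apply smul_right_injective V hq
        simp only [smul_smul, mul_neg, mul_inv_cancel_left₀ hq]
        linear_combination (norm := module) h0
      generalize -(q⁻¹ * r) = s at ha
      have ha' : μ a a = (s ^ 2) • μ (μ a a) (μ a a) := by
        have h5 := congrArg (μ a) ha
        rw [map_smul, ← h4] at h5
        rw [h5, smul_smul] at ha
        rw [sq, ← ha]
      have hu := hidem ((s ^ 2) • μ a a) (by
        rw [map_smul, map_smul, LinearMap.smul_apply, ← ha'])
      rw [← LinearMap.smul_apply, ← map_smul, hu, map_zero, LinearMap.zero_apply] at ha'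
      rw [ha', map_zero]
  · have ha : a = (-(p⁻¹ * q)) • μ a a + (-(p⁻¹ * r)) • μ a (μ a a) := by
      apply smul_right_injective V hp
      simp only [smul_add, smul_smul, mul_neg, mul_inv_cancel_left₀ hp]
      linear_combination (norm := module) h0
    generalize -(p⁻¹ * q) = s at ha
    generalize -(p⁻¹ * r) = s' at ha
    -- The element `u` acts as the identity on the powers of `a`, and is itself one of them.
    generalize hu : s • a + s' • μ a a = u
    have hua : μ u a = a := by
      rw [← hu, map_add, map_smul, map_smul, LinearMap.add_apply, LinearMap.smul_apply,
        LinearMap.smul_apply, hJ.comm (μ a a) a]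
      exact ha.symm
    have huaa : μ u (μ a a) = μ a a := by
      have h5 : μ u (μ a a) = μ a (μ u a) := by
        simp only [← hu, map_add, map_smul, LinearMap.add_apply, LinearMap.smul_apply,
          hJ.commute_sq]
      rw [h5, hua]
    have huu : u = 0 := hidem u (by
      conv_lhs => rw [← hu]
      rw [hJ.comm, map_add, map_smul, map_smul]
      conv_lhs => rw [hu]
      rw [hua, huaa, hu])
    rw [huu, map_zero, LinearMap.zero_apply] at hua
    rw [← hua]
    simp

/-- In a three-dimensional Jordan algebra with `a³ = 0` throughout, either all products vanish or
there is a basis `x, a, a²` in which `ax = 0` and `x²` is a multiple of `a²`. -/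
theorem IsJordanProduct.assoc_of_cube_eq_zero (hJ : IsJordanProduct μ) (h2 : (2 : k) ≠ 0)
    (hV : Module.finrank k V = 3) (hcube : ∀ a, μ (μ a a) a = 0) (b c d : V) :
    μ (μ b c) d = μ b (μ c d) := by
  have cancel : ∀ w : V, (2 : k) • w = 0 → w = 0 := fun w hw =>
    (smul_eq_zero.1 hw).resolve_left h2
  have hlin : ∀ a b, μ (μ a a) b = -(2 : k) • μ a (μ a b) := by
    intro a b
    have h1 := hcube (b + a)
    have h3 := hcube (b - a)
    have h4 := hcube b
    simp only [map_add, map_sub, LinearMap.add_apply, LinearMap.sub_apply, hJ.comm b a, h4,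
      hJ.comm (μ a b) a, hcube a] at h1 h3
    rw [← sub_eq_zero]
    apply cancel
    linear_combination (norm := module) h1 + h3
  have hL3 : ∀ a b, μ a (μ a (μ a b)) = 0 := by
    intro a b
    have h := hJ.mul_cube a b
    rw [hcube, map_zero, LinearMap.zero_apply, hlin] at h
    apply cancel
    apply cancel
    apply cancel
    linear_combination (norm := module) h
  by_cases hsq : ∀ a, μ a a = 0
  · have hzero : ∀ a b, μ a b = 0 := by
      intro a b
      have h := hsq (a + b)
      simp only [map_add, LinearMap.add_apply, hsq, hJ.comm b a] at h
      apply cancel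
      linear_combination (norm := module) h
    simp [hzero]
  push Not at hsq
  obtain ⟨a, haa⟩ := hsq
  have haaa := hcube a
  have haaa' : μ a (μ a a) = 0 := by rw [hJ.comm, haaa]
  have haa4 : μ (μ a a) (μ a a) = 0 := by rw [hlin, haaa', map_zero, smul_zero]
  have hli : LinearIndependent k ![a, μ a a] := by
    rw [LinearIndependent.pair_iff]
    intro p q h
    have h1 := congrArg (μ a) h
    simp only [map_add, map_smul, haaa', smul_zero, add_zero, map_zero] at h1
    obtain rfl := (smul_eq_zero.1 h1).resolve_right haa
    rw [zero_smul, zero_add] at h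
    exact ⟨rfl, (smul_eq_zero.1 h).resolve_right haa⟩
  obtain ⟨y, hy⟩ := exists_notMem_span_pair hV a (μ a a)
  obtain ⟨q, p, hay⟩ : ∃ q p : k, μ a y = p • a + q • μ a a := by
    obtain ⟨r, p, q, h⟩ := exists_coords_of_linearIndependent hV
      (linearIndependent_triple_of_notMem hli hy) (μ a y)
    refine ⟨q, p, ?_⟩
    have h3 := hL3 a y
    simp only [h, map_add, map_smul, haaa', smul_zero, add_zero] at h3
    have h5 := ((linearIndependent_triple_of_notMem hli hy).eq_zero_of_triple (p := r * r * r)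
      (q := r * r * p) (r := r * r * q + r * p) (by linear_combination (norm := module) h3)).1
    have hr : r = 0 := by simpa using h5
    rw [h, hr, zero_smul, zero_add]
  obtain ⟨x, hx, hax'⟩ : ∃ x, x ∉ Submodule.span k {a, μ a a} ∧ μ a x = p • a := by
    refine ⟨y - q • a, fun h => hy ?_, ?_⟩
    · rw [← sub_add_cancel y (q • a)]
      exact add_mem h (Submodule.smul_mem _ _ (Submodule.subset_span (by simp)))
    · rw [map_sub, map_smul, hay, add_sub_cancel_right]
  have hax : μ a x = 0 := by
    have h := hL3 x a
    simp only [hJ.comm x a, hax', map_smul, smul_smul, smul_eq_zero] at h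
    have ha0 : a ≠ 0 := by
      rintro rfl
      exact haa (map_zero _)
    have hp : p = 0 := by simpa using h.resolve_right ha0
    rw [hax', hp, zero_smul]
  have hxa : μ x a = 0 := by rw [hJ.comm, hax]
  have hspan := exists_coords_of_linearIndependent hV (linearIndependent_triple_of_notMem hli hx)
  obtain ⟨s, hxx⟩ : ∃ s : k, μ x x = s • μ a a := by
    obtain ⟨r, p, q, h⟩ := hspan (μ x x)
    have h1 := hlin x a
    rw [hxa, map_zero, smul_zero, hJ.comm, h] at h1
    simp only [map_add, map_smul, hax, haaa', smul_zero, zero_add, add_zero] at h1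
    obtain rfl := (smul_eq_zero.1 h1).resolve_right haa
    rw [zero_smul, add_zero] at h
    by_cases hr : r = 0
    · exact ⟨q, by rw [h, hr, zero_smul, zero_add]⟩
    · refine ⟨0, ?_⟩
      have h3 := hcube x
      rw [hJ.comm, h, map_add, map_smul, map_smul, hJ.comm x (μ a a), hlin, hax, map_zero,
        smul_zero, smul_zero, add_zero] at h3
      rw [(smul_eq_zero.1 h3).resolve_left hr, zero_smul]
  have hxaa : μ x (μ a a) = 0 := by rw [hJ.comm, hlin, hax, map_zero, smul_zero]
  have haax : μ (μ a a) x = 0 := by rw [hJ.comm, hxaa]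
  refine assoc_of_commute_of_span hJ.comm hspan (fun v => ?_) (fun v => ?_) (fun v => ?_) b c d <;>
  · obtain ⟨p, q, r, rfl⟩ := hspan v
    simp [hxx, hxa, hax, hxaa, haax, haaa, haaa', haa4]

/-- Either some idempotent has a Peirce component of eigenvalue `½`, and there is an explicit
matrix model, or the algebra is associative. -/
theorem IsJordanProduct.isSpecialProduct_of_finrank_eq_three [IsAlgClosed k]
    (hJ : IsJordanProduct μ) (h2 : (2 : k) ≠ 0) (hV : Module.finrank k V = 3) :
    IsSpecialProduct μ := by
  by_cases H : ∀ e n, μ e e = e → μ e n = (2⁻¹ : k) • n → n = 0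
  · refine isSpecialProduct_of_assoc hJ.comm fun a b c => ?_
    by_cases hidem : ∀ e, μ e e = e → e = 0
    · by_cases hli : ∃ a, LinearIndependent k ![a, μ a a, μ (μ a a) a]
      · obtain ⟨x, hx⟩ := hli
        exact hJ.assoc_of_powers_span (exists_coords_of_linearIndependent hV hx) a b c
      · push Not at hli
        exact hJ.assoc_of_cube_eq_zero h2 hV (fun x => hJ.cube_eq_zero hidem (hli x)) a b c
    · push Not at hidem
      obtain ⟨e, he, he0⟩ := hidem
      exact hJ.assoc_of_idempotent h2 hV H he he0 a b c
  · push Not at H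
    obtain ⟨e, n, he, hn, hn0⟩ := H
    exact isSpecialProduct_of_half hJ hV he (mul_inv_cancel₀ h2) hn hn0

/-- Smaller algebras are padded to dimension three by a direct summand with zero product. -/
theorem IsJordanProduct.isSpecialProduct_of_finrank_le_three [IsAlgClosed k]
    [FiniteDimensional k V] (hJ : IsJordanProduct μ) (h2 : (2 : k) ≠ 0)
    (hV : Module.finrank k V ≤ 3) : IsSpecialProduct μ := by
  let W := Fin (3 - Module.finrank k V) → k
  let ν : (V × W) →ₗ[k] (V × W) →ₗ[k] (V × W) :=
    (μ.compl₁₂ (LinearMap.fst k V W) (LinearMap.fst k V W)).compr₂ (LinearMap.inl k V W)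
  have hν : ∀ a b, ν a b = (μ a.1 b.1, 0) := fun _ _ => rfl
  have hJν : IsJordanProduct ν := by
    refine ⟨fun a b => ?_, fun a b c d => ?_, fun a b => ?_⟩
    · rw [hν, hν, hJ.comm]
    · simp only [hν, Prod.mk_add_mk, hJ.linearized a.1 b.1 c.1 d.1]
    · simp only [hν, hJ.jordan]
  obtain ⟨B, i1, i2, i3, i4, σ, hσ, hmul⟩ := hJν.isSpecialProduct_of_finrank_eq_three h2 (by
    rw [Module.finrank_prod, Module.finrank_fin_fun]
    omega)
  refine ⟨B, i1, i2, i3, i4, σ ∘ₗ LinearMap.inl k V W,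
    hσ.comp (LinearMap.inl_injective), fun a b => hmul (a, 0) (b, 0)⟩

end Associative

end JordanProduct

/-! ### From ungraded to graded realizations -/

section Super

variable {k : Type u} {J : Type u} [Field k] [NonUnitalNonAssocRing J] [Module k J]
  {𝒥 : ZMod 2 → Submodule k J}

theorem superSign_add (k : Type u) [Field k] (i j : ZMod 2) :
    superSign k (i + j) = superSign k i * superSign k j := by
  have h11 : (1 : ZMod 2) + 1 = 0 := rfl
  obtain rfl | rfl := ZMod.eq_zero_or_eq_one_of_two i <;>
  obtain rfl | rfl := ZMod.eq_zero_or_eq_one_of_two j <;>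
  simp [superSign_zero, superSign_one, h11]

theorem isInternal_iff_isCompl_of_two {A : Type*} [AddCommGroup A] [Module k A]
    (𝒜 : ZMod 2 → Submodule k A) : DirectSum.IsInternal 𝒜 ↔ IsCompl (𝒜 0) (𝒜 1) :=
  DirectSum.isInternal_submodule_iff_isCompl _ (by decide) (by ext i; revert i; simp; decide)

theorem IsSuperalgebra.isCompl (hJ : IsSuperalgebra k 𝒥) : IsCompl (𝒥 0) (𝒥 1) :=
  (isInternal_iff_isCompl_of_two 𝒥).1 hJ.isInternal

theorem IsSuperalgebra.exists_eq_add (hJ : IsSuperalgebra k 𝒥) (a : J) :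
    ∃ a0 ∈ 𝒥 0, ∃ a1 ∈ 𝒥 1, a = a0 + a1 := by
  have h : a ∈ 𝒥 0 ⊔ 𝒥 1 := by rw [hJ.isCompl.sup_eq_top]; trivial
  obtain ⟨a0, h0, a1, h1, rfl⟩ := Submodule.mem_sup.1 h
  exact ⟨a0, h0, a1, h1, rfl⟩

/-- For the specialness of `J` a grading on the associative algebra is not needed: from any `B`
that realizes the two signed products one passes to `B × B`, graded by the pairs `(x, x)` and
`(x, -x)`, which is the group algebra of `ℤ/2` over `B`. -/
theorem IsJordanSuperalgebra.isSpecial_of_ungraded (hJ : IsJordanSuperalgebra k 𝒥)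
    (h2 : (2 : k) ≠ 0) {B : Type u} [NonUnitalRing B] [Module k B] [IsScalarTower k B B]
    [SMulCommClass k B B] (φ : J →ₗ[k] B) (hφ : Function.Injective φ)
    (heven : ∀ i, ∀ a ∈ 𝒥 0, ∀ b ∈ 𝒥 i, (2 : k) • φ (a * b) = φ a * φ b + φ b * φ a)
    (hodd : ∀ a ∈ 𝒥 1, ∀ b ∈ 𝒥 1, (2 : k) • φ (a * b) = φ a * φ b - φ b * φ a) :
    IsSpecialSuperalgebra k 𝒥 := by
  let θ : J →ₗ[k] J := LinearMap.ofIsCompl hJ.isCompl (𝒥 0).subtype (-(𝒥 1).subtype)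
  have hθ : ∀ i, ∀ a ∈ 𝒥 i, θ a = superSign k i • a := by
    intro i a ha
    obtain rfl | rfl := ZMod.eq_zero_or_eq_one_of_two i
    · rw [superSign_zero, one_smul]
      exact LinearMap.ofIsCompl_apply_left hJ.isCompl ⟨a, ha⟩
    · rw [superSign_one, neg_one_smul]
      exact LinearMap.ofIsCompl_apply_right hJ.isCompl ⟨a, ha⟩
  let 𝒜 : ZMod 2 → Submodule k (B × B) := fun i =>
    LinearMap.range (LinearMap.prod LinearMap.id (superSign k i • LinearMap.id : B →ₗ[k] B))
  have h𝒜 : ∀ i (x : B × B), x ∈ 𝒜 i ↔ x.2 = superSign k i • x.1 := by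
    intro i x
    constructor
    · rintro ⟨y, rfl⟩
      rfl
    · intro h
      exact ⟨x.1, Prod.ext rfl h.symm⟩
  have hmul : ∀ i j, ∀ a ∈ 𝒥 i, ∀ b ∈ 𝒥 j, φ (a * b) = plusMul k i j (φ a) (φ b) := by
    have h11 : (1 : ZMod 2) * 1 = 1 := rfl
    intro i j a ha b hb
    apply smul_right_injective B h2
    simp only [plusMul]
    rw [smul_inv_smul₀ h2]
    obtain rfl | rfl := ZMod.eq_zero_or_eq_one_of_two i
    · rw [heven j a ha b hb, zero_mul, superSign_zero, one_smul]
    · obtain rfl | rfl := ZMod.eq_zero_or_eq_one_of_two j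
      · rw [hJ.supercomm 1 0 a b ha hb, mul_zero, superSign_zero, one_smul, one_smul,
          heven 1 b hb a ha, add_comm]
      · rw [hodd a ha b hb, h11, superSign_one, neg_one_smul, sub_eq_add_neg]
  refine ⟨B × B, inferInstance, inferInstance, inferInstance, inferInstance, 𝒜,
    φ.prod (φ ∘ₗ θ), ⟨?_, ?_⟩, ⟨?_, ?_, ?_⟩⟩
  · rw [isInternal_iff_isCompl_of_two]
    refine IsCompl.of_eq ?_ ?_
    · rw [eq_bot_iff]
      rintro ⟨x, y⟩ ⟨h0, h1⟩
      have h0 : y = superSign k 0 • x := (h𝒜 0 (x, y)).1 h0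
      have h1 : y = superSign k 1 • x := (h𝒜 1 (x, y)).1 h1
      rw [superSign_zero, one_smul] at h0
      rw [superSign_one, neg_one_smul, h0] at h1
      have hx : x = 0 := by
        refine (smul_eq_zero.1 (?_ : (2 : k) • x = 0)).resolve_left h2
        linear_combination (norm := module) h1
      rw [h0, hx]
      exact zero_mem _
    · rw [eq_top_iff]
      rintro ⟨x, y⟩ -
      refine Submodule.mem_sup.2 ⟨((2 : k)⁻¹ • (x + y), (2 : k)⁻¹ • (x + y)), ?_,
        ((2 : k)⁻¹ • (x - y), -((2 : k)⁻¹ • (x - y))), ?_, ?_⟩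
      · rw [h𝒜, superSign_zero, one_smul]
      · rw [h𝒜, superSign_one, neg_one_smul]
      · have h : (2 : k)⁻¹ * 2 = 1 := inv_mul_cancel₀ h2
        refine Prod.ext ?_ ?_
        · show (2 : k)⁻¹ • (x + y) + (2 : k)⁻¹ • (x - y) = x
          linear_combination (norm := module) h • x
        · show (2 : k)⁻¹ • (x + y) + -((2 : k)⁻¹ • (x - y)) = y
          linear_combination (norm := module) h • y
  · intro i j x y hx hy
    rw [h𝒜] at hx hy ⊢
    rw [Prod.snd_mul, Prod.fst_mul, hx, hy, smul_mul_smul_comm, superSign_add]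
  · intro a b h
    exact hφ (congrArg Prod.fst h)
  · intro i a ha
    rw [h𝒜]
    show φ (θ a) = _ • φ a
    rw [hθ i a ha, map_smul]
  · intro i j a b ha hb
    have h := hmul i j a ha b hb
    refine Prod.ext h ?_
    show φ (θ (a * b)) = (2 : k)⁻¹ • (φ (θ a) * φ (θ b) + superSign k (i * j) • (φ (θ b) * φ (θ a)))
    rw [hθ _ _ (hJ.mul_mem i j a b ha hb), hθ i a ha, hθ j b hb, map_smul, map_smul, map_smul, h,
      plusMul, superSign_add]
    simp only [smul_mul_smul_comm]
    module

theorem IsJordanSuperalgebra.odd_mul_self (hJ : IsJordanSuperalgebra k 𝒥) (h2 : (2 : k) ≠ 0)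
    {a : J} (ha : a ∈ 𝒥 1) : a * a = 0 := by
  have h := hJ.supercomm 1 1 a a ha ha
  rw [show (1 : ZMod 2) * 1 = 1 from rfl, superSign_one] at h
  refine (smul_eq_zero.1 (?_ : (2 : k) • (a * a) = 0)).resolve_left h2
  linear_combination (norm := module) h

/-- Without an even part all products vanish, and the trivial square-zero extension is an envelope.
-/
theorem IsJordanSuperalgebra.isSpecial_of_even_eq_bot
    [FiniteDimensional k J] (hJ : IsJordanSuperalgebra k 𝒥) (h2 : (2 : k) ≠ 0)
    (h0 : 𝒥 0 = ⊥) : IsSpecialSuperalgebra k 𝒥 := by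
  let ι := (Module.finBasis k J).equivFun
  refine hJ.isSpecial_of_ungraded h2 (B := TrivSqZeroExt k (Fin (Module.finrank k J) → k))
    (TrivSqZeroExt.inrHom k _ ∘ₗ ι.toLinearMap) ?_ ?_ ?_
  · exact TrivSqZeroExt.inr_injective.comp ι.injective
  · intro i a ha b _
    rw [h0, Submodule.mem_bot] at ha
    simp [ha]
  · intro a ha b hb
    have h := hJ.mul_mem 1 1 a b ha hb
    rw [show (1 : ZMod 2) + 1 = 0 from rfl, h0, Submodule.mem_bot] at h
    simp [h]

variable [SMulCommClass k J J] [IsScalarTower k J J]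

/-- If the odd part has dimension at most one, the product of odd elements vanishes, and `J` is a
Jordan algebra in the ordinary sense when its grading is forgotten. In an ungraded realization the
images of odd elements are proportional and commute, as the super product requires. -/
theorem IsJordanSuperalgebra.isSpecial_of_finrank_odd_le_one [IsAlgClosed k]
    [FiniteDimensional k J] (hJ : IsJordanSuperalgebra k 𝒥) (h2 : (2 : k) ≠ 0)
    (hd : Module.finrank k J ≤ 3) (h1 : Module.finrank k (𝒥 1) ≤ 1) :
    IsSpecialSuperalgebra k 𝒥 := by
  obtain ⟨w, hw⟩ := finrank_le_one_iff.1 h1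
  have hw' : ∀ a ∈ 𝒥 1, ∃ c : k, a = c • (w : J) := fun a ha => by
    obtain ⟨c, hc⟩ := hw ⟨a, ha⟩
    exact ⟨c, congrArg Subtype.val hc.symm⟩
  have hII : ∀ a b, a ∈ 𝒥 1 → b ∈ 𝒥 1 → a * b = 0 := by
    intro a b ha hb
    obtain ⟨c, rfl⟩ := hw' a ha
    obtain ⟨d, rfl⟩ := hw' b hb
    rw [smul_mul_smul_comm, hJ.odd_mul_self h2 w.2, smul_zero]
  have hcomm : ∀ a b : J, a * b = b * a := by
    intro a b
    obtain ⟨a0, ha0, a1, ha1, rfl⟩ := hJ.exists_eq_add a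
    obtain ⟨b0, hb0, b1, hb1, rfl⟩ := hJ.exists_eq_add b
    have h00 := hJ.supercomm 0 0 a0 b0 ha0 hb0
    have h01 := hJ.supercomm 0 1 a0 b1 ha0 hb1
    have h10 := hJ.supercomm 1 0 a1 b0 ha1 hb0
    simp only [zero_mul, mul_zero, superSign_zero, one_smul] at h00 h01 h10
    simp only [add_mul, mul_add, h00, h01, h10, hII a1 b1 ha1 hb1, hII b1 a1 hb1 ha1]
    abel
  have hIr : ∀ a b, a ∈ 𝒥 1 → a * b ∈ 𝒥 1 := by
    intro a b ha
    obtain ⟨b0, hb0, b1, hb1, rfl⟩ := hJ.exists_eq_add b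
    rw [mul_add, hII a b1 ha hb1, add_zero]
    exact hJ.mul_mem 1 0 a b0 ha hb0
  have hIl : ∀ a b, b ∈ 𝒥 1 → a * b ∈ 𝒥 1 := fun a b hb => hcomm b a ▸ hIr b a hb
  have hIr' : ∀ a b c, a ∈ 𝒥 1 → a * b * c ∈ 𝒥 1 := fun a b c ha => hIr _ c (hIr a b ha)
  have hIl' : ∀ a b c, b ∈ 𝒥 1 → a * b * c ∈ 𝒥 1 := fun a b c hb => hIr _ c (hIl a b hb)
  have hlin : ∀ a b c d : J, (a * b) * (c * d) + (a * c) * (b * d) + (a * d) * (b * c)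
      = ((a * b) * c) * d + ((a * d) * c) * b + ((b * d) * c) * a := by
    have hhom : ∀ p q r s : ZMod 2, ∀ a ∈ 𝒥 p, ∀ b ∈ 𝒥 q, ∀ c ∈ 𝒥 r, ∀ d ∈ 𝒥 s,
        (a * b) * (c * d) + (a * c) * (b * d) + (a * d) * (b * c)
          = ((a * b) * c) * d + ((a * d) * c) * b + ((b * d) * c) * a := by
      intro p q r s a ha b hb c hc d hd
      have h := hJ.super_jordan p q r s a b c d ha hb hc hd
      -- Either at most one argument is odd, and all signs are `1`, or every term vanishes.
      obtain rfl | rfl := ZMod.eq_zero_or_eq_one_of_two p <;>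
      obtain rfl | rfl := ZMod.eq_zero_or_eq_one_of_two q <;>
      obtain rfl | rfl := ZMod.eq_zero_or_eq_one_of_two r <;>
      obtain rfl | rfl := ZMod.eq_zero_or_eq_one_of_two s <;>
      first
      | simpa only [zero_mul, mul_zero, add_zero, superSign_zero, one_smul] using h
      | simp [hII, hIr, hIl, hIr', hIl', ha, hb, hc, hd]
    intro a b c d
    obtain ⟨a0, ha0, a1, ha1, rfl⟩ := hJ.exists_eq_add a
    obtain ⟨b0, hb0, b1, hb1, rfl⟩ := hJ.exists_eq_add b
    obtain ⟨c0, hc0, c1, hc1, rfl⟩ := hJ.exists_eq_add c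
    obtain ⟨d0, hd0, d1, hd1, rfl⟩ := hJ.exists_eq_add d
    have key := fun (p q r s : ZMod 2) (a ha b hb c hc d hd) =>
      sub_eq_zero.2 (hhom p q r s a ha b hb c hc d hd)
    rw [← sub_eq_zero]
    simp only [add_mul, mul_add]
    linear_combination (norm := abel)
      key 0 0 0 0 a0 ha0 b0 hb0 c0 hc0 d0 hd0 + key 0 0 0 1 a0 ha0 b0 hb0 c0 hc0 d1 hd1
      + key 0 0 1 0 a0 ha0 b0 hb0 c1 hc1 d0 hd0 + key 0 0 1 1 a0 ha0 b0 hb0 c1 hc1 d1 hd1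
      + key 0 1 0 0 a0 ha0 b1 hb1 c0 hc0 d0 hd0 + key 0 1 0 1 a0 ha0 b1 hb1 c0 hc0 d1 hd1
      + key 0 1 1 0 a0 ha0 b1 hb1 c1 hc1 d0 hd0 + key 0 1 1 1 a0 ha0 b1 hb1 c1 hc1 d1 hd1
      + key 1 0 0 0 a1 ha1 b0 hb0 c0 hc0 d0 hd0 + key 1 0 0 1 a1 ha1 b0 hb0 c0 hc0 d1 hd1
      + key 1 0 1 0 a1 ha1 b0 hb0 c1 hc1 d0 hd0 + key 1 0 1 1 a1 ha1 b0 hb0 c1 hc1 d1 hd1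
      + key 1 1 0 0 a1 ha1 b1 hb1 c0 hc0 d0 hd0 + key 1 1 0 1 a1 ha1 b1 hb1 c0 hc0 d1 hd1
      + key 1 1 1 0 a1 ha1 b1 hb1 c1 hc1 d0 hd0 + key 1 1 1 1 a1 ha1 b1 hb1 c1 hc1 d1 hd1
  have hJord : IsJordanProduct (LinearMap.mul k J) := by
    refine ⟨hcomm, hlin, fun a b => ?_⟩
    simp only [LinearMap.mul_apply']
    obtain ⟨a0, ha0, a1, ha1, rfl⟩ := hJ.exists_eq_add a
    have h := hlin a0 a0 b a1
    have h0 := hJ.even_jordan a0 b ha0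
    simp only [add_mul, mul_add, hcomm a1 a0, hII a1 a1 ha1 ha1, add_zero,
      hII (a0 * a1) (b * a1) (hIl _ _ ha1) (hIl _ _ ha1),
      hII (a0 * a1 * b) a1 (hIr _ _ (hIl _ _ ha1)) ha1, h0]
    rw [hcomm (a0 * b) (a0 * a1), hcomm a0 b] at h
    linear_combination (norm := abel) h
  obtain ⟨B, _, _, _, _, σ, hσ, hmul⟩ := hJord.isSpecialProduct_of_finrank_le_three h2 hd
  refine hJ.isSpecial_of_ungraded h2 σ hσ (fun i a _ b _ => hmul a b) fun a ha b hb => ?_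
  obtain ⟨c, rfl⟩ := hw' a ha
  obtain ⟨d, rfl⟩ := hw' b hb
  rw [hII _ _ ha hb]
  simp only [map_zero, map_smul, smul_mul_smul_comm, smul_zero, mul_comm c d, sub_self]

section TypeOneTwo

variable {n z w : J}

/-- In dimension `(1|2)` it suffices to choose images `N`, `Z`, `W` of a homogeneous basis and to
compare four products. -/
theorem IsJordanSuperalgebra.isSpecial_of_triple (hJ : IsJordanSuperalgebra k 𝒥)
    (h2 : (2 : k) ≠ 0) (hz : z ∈ 𝒥 1) (hw : w ∈ 𝒥 1)
    (hspan0 : ∀ a ∈ 𝒥 0, ∃ c : k, a = c • n) (hspan1 : ∀ a ∈ 𝒥 1, ∃ p q : k, a = p • z + q • w)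
    (hli : LinearIndependent k ![n, z, w]) (hd : Module.finrank k J = 3)
    {B : Type u} [NonUnitalRing B] [Module k B] [IsScalarTower k B B] [SMulCommClass k B B]
    (N Z W : B) (hinj : ∀ p q r : k, p • N + q • Z + r • W = 0 → p = 0 ∧ q = 0 ∧ r = 0)
    {c p q p' q' β : k}
    (hnn : n * n = c • n) (hNN : N * N + N * N = (2 : k) • c • N)
    (hnz : n * z = p • z + q • w) (hNZ : N * Z + Z * N = (2 : k) • (p • Z + q • W))
    (hnw : n * w = p' • z + q' • w) (hNW : N * W + W * N = (2 : k) • (p' • Z + q' • W))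
    (hzw : z * w = β • n) (hZW : Z * W - W * Z = (2 : k) • β • N) :
    IsSpecialSuperalgebra k 𝒥 := by
  have : FiniteDimensional k J := Module.finite_of_finrank_eq_succ hd
  let b := basisOfLinearIndependentOfCardEqFinrank hli (by simp [hd])
  let σ : J →ₗ[k] B := b.constr k ![N, Z, W]
  have hN : σ n = N := by simpa [b, σ] using b.constr_basis k ![N, Z, W] 0
  have hZ : σ z = Z := by simpa [b, σ] using b.constr_basis k ![N, Z, W] 1
  have hW : σ w = W := by simpa [b, σ] using b.constr_basis k ![N, Z, W] 2
  have hzz := hJ.odd_mul_self h2 hz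
  have hww := hJ.odd_mul_self h2 hw
  have hwz : w * z = -(β • n) := by
    rw [hJ.supercomm 1 1 w z hw hz, show (1 : ZMod 2) * 1 = 1 from rfl, superSign_one,
      neg_one_smul, hzw]
  refine hJ.isSpecial_of_ungraded h2 σ ?_ ?_ ?_
  · rw [injective_iff_map_eq_zero]
    intro v hv
    obtain ⟨p, q, r, rfl⟩ := exists_coords_of_linearIndependent hd hli v
    simp only [map_add, map_smul, hN, hZ, hW] at hv
    obtain ⟨rfl, rfl, rfl⟩ := hinj p q r hv
    simp
  · intro i a ha v hv
    obtain ⟨s, rfl⟩ := hspan0 a ha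
    obtain rfl | rfl := ZMod.eq_zero_or_eq_one_of_two i
    · obtain ⟨t, rfl⟩ := hspan0 v hv
      simp only [smul_mul_smul_comm, hnn, map_smul, hN]
      linear_combination (norm := module) -(s * t) • hNN
    · obtain ⟨t, t', rfl⟩ := hspan1 v hv
      simp only [mul_add, add_mul, smul_mul_smul_comm, hnz, hnw, map_add, map_smul, hN, hZ, hW]
      linear_combination (norm := module) -(s * t) • hNZ - (s * t') • hNW
  · intro a ha v hv
    obtain ⟨s, s', rfl⟩ := hspan1 a ha
    obtain ⟨t, t', rfl⟩ := hspan1 v hv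
    simp only [mul_add, add_mul, smul_mul_smul_comm, hzz, hww, hzw, hwz, map_add, map_smul, hN,
      hZ, hW, map_neg, smul_zero, zero_add, add_zero]
    linear_combination (norm := module) -(s * t' - s' * t) • hZW

end TypeOneTwo

end Super

/-! ### Superalgebras with one even and two odd dimensions -/

section TypeOneTwoModels

open Polynomial

variable {k : Type u} [Field k]

/-- The `2 × 2` block that `m` occupies relative to the idempotent `diag(1, 0)`: for `s = 1`, `½`,
`0` the only nonzero entry of `peirceBlock s m` is `m`, in position `(0, 0)`, `(0, 1)`, `(1, 1)`
respectively. -/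
def peirceBlock {C : Type*} [AddCommGroup C] [Module k C] (s : k) (m : C) :
    Matrix (Fin 2) (Fin 2) C :=
  !![(s * (2 * s - 1)) • m, (4 * s * (1 - s)) • m; 0, ((1 - s) * (1 - 2 * s)) • m]

theorem peirceBlock_relation {C : Type*} [Ring C] [Algebra k C] {s : k}
    (hs : s = 0 ∨ 2 * s = 1 ∨ s = 1) (m : C) :
    !![1, 0; 0, 0] * peirceBlock s m + peirceBlock s m * !![1, 0; 0, 0]
      = (2 : k) • s • peirceBlock s m := by
  have h1 : s * (2 * s - 1) * (s - 1) = 0 := by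
    obtain rfl | hs | rfl := hs
    · simp
    · rw [hs]; simp
    · simp
  ext i j
  fin_cases i <;> fin_cases j <;> simp [peirceBlock, Matrix.mul_apply]
  · linear_combination (norm := module) -(2 : k) • h1 • m
  · linear_combination (norm := module) (4 : k) • h1 • m
  · linear_combination (norm := module) -(2 : k) • h1 • m

/-- The Weyl relation, on polynomials over a field of any characteristic. -/
theorem derivative_mul_mulLeft_X :
    (derivative : Module.End k k[X]) * LinearMap.mulLeft k X
      = LinearMap.mulLeft k X * derivative + 1 := by
  refine LinearMap.ext fun p => ?_
  simp [derivative_mul, add_comm]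

end TypeOneTwoModels

section TypeOneTwo

open Polynomial

variable {k : Type u} {J : Type u} [Field k] [NonUnitalNonAssocRing J] [Module k J]
  {𝒥 : ZMod 2 → Submodule k J} [SMulCommClass k J J] [IsScalarTower k J J] {n e z w : J}

/-- An even idempotent acting on an odd part with zero product: `2 × 2` matrices over the trivial
square-zero extension, where the odd elements commute. -/
theorem IsJordanSuperalgebra.isSpecial_of_peirce_triple (hJ : IsJordanSuperalgebra k 𝒥)
    (h2 : (2 : k) ≠ 0) (hz : z ∈ 𝒥 1) (hw : w ∈ 𝒥 1)
    (hspan0 : ∀ a ∈ 𝒥 0, ∃ c : k, a = c • e) (hspan1 : ∀ a ∈ 𝒥 1, ∃ p q : k, a = p • z + q • w)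
    (hli : LinearIndependent k ![e, z, w]) (hd : Module.finrank k J = 3)
    (hee : e * e = e) {s t : k} (hez : e * z = s • z) (hew : e * w = t • w)
    (hs : s = 0 ∨ 2 * s = 1 ∨ s = 1) (ht : t = 0 ∨ 2 * t = 1 ∨ t = 1)
    (hzw : z * w = (0 : k) • e) : IsSpecialSuperalgebra k 𝒥 := by
  have hee' : e * e = (1 : k) • e := by rw [hee, one_smul]
  have hez' : e * z = s • z + (0 : k) • w := by rw [hez, zero_smul, add_zero]
  have hew' : e * w = (0 : k) • z + t • w := by rw [hew, zero_smul, zero_add]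
  refine hJ.isSpecial_of_triple h2 hz hw hspan0 hspan1 hli hd
    (B := Matrix (Fin 2) (Fin 2) (TrivSqZeroExt k (Fin 2 → k)))
    !![1, 0; 0, 0] (peirceBlock s (TrivSqZeroExt.inr ![1, 0]))
    (peirceBlock t (TrivSqZeroExt.inr ![0, 1])) ?_ hee' ?_ hez' ?_ hew' ?_ hzw ?_
  · intro p q r h
    -- The entries of a Peirce block sum to its argument.
    have h1 : p • (1 : TrivSqZeroExt k (Fin 2 → k)) + q • TrivSqZeroExt.inr ![1, 0]
        + r • TrivSqZeroExt.inr ![0, 1] = 0 := by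
      have h00 := congrFun (congrFun h 0) 0
      have h01 := congrFun (congrFun h 0) 1
      have h11 := congrFun (congrFun h 1) 1
      simp [peirceBlock] at h00 h01 h11
      linear_combination (norm := module) h00 + h01 + h11
    have h3 := congrArg TrivSqZeroExt.fst h1
    have h4 := congrFun (congrArg TrivSqZeroExt.snd h1)
    have h5 := h4 0
    have h6 := h4 1
    simp at h3 h5 h6
    exact ⟨h3, h5, h6⟩
  · refine Matrix.ext fun i j => ?_
    fin_cases i <;> fin_cases j <;> simp [Matrix.mul_apply, two_smul]
  · rw [peirceBlock_relation hs, zero_smul, add_zero]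
  · rw [peirceBlock_relation ht, zero_smul, zero_add]
  · refine Matrix.ext fun i j => ?_
    fin_cases i <;> fin_cases j <;> simp [peirceBlock, Matrix.mul_apply]

/-- For `β ≠ 0` this is the Kaplansky superalgebra `K₃`. The model consists of `2 × 2` matrices
over the Weyl algebra acting on `k[X]`; in characteristic zero, comparing traces shows that no
finite-dimensional one exists. -/
theorem IsJordanSuperalgebra.isSpecial_of_half_half (hJ : IsJordanSuperalgebra k 𝒥)
    (h2 : (2 : k) ≠ 0) (hz : z ∈ 𝒥 1) (hw : w ∈ 𝒥 1)
    (hspan0 : ∀ a ∈ 𝒥 0, ∃ c : k, a = c • e) (hspan1 : ∀ a ∈ 𝒥 1, ∃ p q : k, a = p • z + q • w)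
    (hli : LinearIndependent k ![e, z, w]) (hd : Module.finrank k J = 3)
    (hee : e * e = e) {s t β : k} (hez : e * z = s • z) (hew : e * w = t • w)
    (hs : 2 * s = 1) (ht : 2 * t = 1) (hzw : z * w = β • e) : IsSpecialSuperalgebra k 𝒥 := by
  have hee' : e * e = (1 : k) • e := by rw [hee, one_smul]
  have hez' : e * z = s • z + (0 : k) • w := by rw [hez, zero_smul, add_zero]
  have hew' : e * w = (0 : k) • z + t • w := by rw [hew, zero_smul, zero_add]
  -- Off-diagonal entries `a, b` of `Z` and `c, d` of `W` have to satisfy `ad - cb = 2β` and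
  -- `bc = da`; with `b = 1` and `d = X` this says that `a` is `2β` times the derivative.
  have hDM := derivative_mul_mulLeft_X (k := k)
  have hM1 : LinearMap.mulLeft k (X : k[X]) (1 : k[X]) = X := by simp
  generalize (derivative : Module.End k k[X]) = D at hDM
  generalize LinearMap.mulLeft k (X : k[X]) = M at hDM hM1
  refine hJ.isSpecial_of_triple h2 hz hw hspan0 hspan1 hli hd
    (B := Matrix (Fin 2) (Fin 2) (Module.End k k[X]))
    !![1, 0; 0, 0] !![0, (2 * β) • D; 1, 0] !![0, (2 * β) • (M * D); M, 0]
    ?_ hee' ?_ hez' ?_ hew' ?_ hzw ?_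
  · intro p q r h
    have h00 := congrFun (congrFun h 0) 0
    have h10 := LinearMap.congr_fun (congrFun (congrFun h 1) 0) (1 : k[X])
    simp [hM1] at h00 h10
    have h3 := congrArg (coeff · 0) h10
    have h4 := congrArg (coeff · 1) h10
    simp [coeff_one] at h3 h4
    exact ⟨h00, h3, h4⟩
  · refine Matrix.ext fun i j => ?_
    fin_cases i <;> fin_cases j <;> simp [Matrix.mul_apply, two_smul]
  · rw [zero_smul, add_zero, smul_smul, hs, one_smul]
    refine Matrix.ext fun i j => ?_
    fin_cases i <;> fin_cases j <;> simp [Matrix.mul_apply]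
  · rw [zero_smul, zero_add, smul_smul, ht, one_smul]
    refine Matrix.ext fun i j => ?_
    fin_cases i <;> fin_cases j <;> simp [Matrix.mul_apply]
  · refine Matrix.ext fun i j => ?_
    fin_cases i <;> fin_cases j <;> simp [Matrix.mul_apply, hDM, smul_smul]

/-- The superalgebra of a nondegenerate alternating form on the odd part, realized by the Weyl
algebra on `k[X]`. -/
theorem IsJordanSuperalgebra.isSpecial_of_unit_triple (hJ : IsJordanSuperalgebra k 𝒥)
    (h2 : (2 : k) ≠ 0) (hz : z ∈ 𝒥 1) (hw : w ∈ 𝒥 1)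
    (hspan0 : ∀ a ∈ 𝒥 0, ∃ c : k, a = c • e) (hspan1 : ∀ a ∈ 𝒥 1, ∃ p q : k, a = p • z + q • w)
    (hli : LinearIndependent k ![e, z, w]) (hd : Module.finrank k J = 3)
    (hee : e * e = e) {s t β : k} (hez : e * z = s • z) (hew : e * w = t • w)
    (hs : s = 1) (ht : t = 1) (hβ : β ≠ 0) (hzw : z * w = β • e) :
    IsSpecialSuperalgebra k 𝒥 := by
  have hee' : e * e = (1 : k) • e := by rw [hee, one_smul]
  have hez' : e * z = s • z + (0 : k) • w := by rw [hez, zero_smul, add_zero]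
  have hew' : e * w = (0 : k) • z + t • w := by rw [hew, zero_smul, zero_add]
  have hDM := derivative_mul_mulLeft_X (k := k)
  refine hJ.isSpecial_of_triple h2 hz hw hspan0 hspan1 hli hd (B := Module.End k k[X])
    1 (LinearMap.mulLeft k X) (-(2 * β) • derivative) ?_ hee' ?_ hez' ?_ hew' ?_ hzw ?_
  · intro p q r h
    have h3 := LinearMap.congr_fun h (1 : k[X])
    have h4 := LinearMap.congr_fun h (X : k[X])
    simp at h3 h4
    have h5 := congrArg (coeff · 0) h3
    have h6 := congrArg (coeff · 1) h3
    simp [coeff_one] at h5 h6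
    subst h5 h6
    simpa [h2, hβ] using h4
  · rw [mul_one]; module
  · rw [one_mul, mul_one, hs]; module
  · rw [one_mul, mul_one, ht]; module
  · rw [mul_smul_comm, smul_mul_assoc, hDM]
    module

/-- For eigenvectors `z`, `w` of an even idempotent with eigenvalues `s`, `t` and `zw = βe`, the
super Jordan identity gives `β (1 - s) (1 - 2t) = 0` and its mirror image. So `β = 0`, or
`s = t = ½`, or `s = t = 1`. -/
theorem IsJordanSuperalgebra.isSpecial_of_idempotent_triple (hJ : IsJordanSuperalgebra k 𝒥)
    (h2 : (2 : k) ≠ 0) (he : e ∈ 𝒥 0) (hz : z ∈ 𝒥 1) (hw : w ∈ 𝒥 1)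
    (hspan0 : ∀ a ∈ 𝒥 0, ∃ c : k, a = c • e) (hspan1 : ∀ a ∈ 𝒥 1, ∃ p q : k, a = p • z + q • w)
    (hli : LinearIndependent k ![e, z, w]) (hd : Module.finrank k J = 3)
    (hee : e * e = e) {s t : k} (hez : e * z = s • z) (hew : e * w = t • w)
    (hs : s = 0 ∨ 2 * s = 1 ∨ s = 1) (ht : t = 0 ∨ 2 * t = 1 ∨ t = 1) :
    IsSpecialSuperalgebra k 𝒥 := by
  have h11 : (1 : ZMod 2) * 1 = 1 := rfl
  have h01 : ∀ q : k, q • e = 0 → q = 0 := fun q hq =>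
    (smul_eq_zero.1 hq).resolve_right (hli.ne_zero 0)
  have key : ∀ {z w : J} {s t β : k}, z ∈ 𝒥 1 → w ∈ 𝒥 1 → e * z = s • z → e * w = t • w →
      z * w = β • e → β * ((1 - s) * (1 - 2 * t)) = 0 := by
    intro z w s t β hz hw hez hew hzw
    have hwz : w * z = -(β • e) := by
      rw [hJ.supercomm 1 1 w z hw hz, h11, superSign_one, neg_one_smul, hzw]
    have h := hJ.super_jordan 0 0 1 1 e e z w he he hz hw
    simp only [zero_mul, zero_add, h11, superSign_zero, superSign_one, hee, hez, hew, hzw, hwz,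
      smul_mul_assoc, mul_smul_comm, mul_zero, neg_mul] at h
    apply h01
    linear_combination (norm := module) h
  obtain ⟨β, hzw⟩ := hspan0 (z * w) (hJ.mul_mem 1 1 z w hz hw)
  have hwz : w * z = (-β) • e := by
    rw [hJ.supercomm 1 1 w z hw hz, h11, superSign_one, neg_one_smul, hzw, neg_smul]
  by_cases hβ : β = 0
  · subst hβ
    exact hJ.isSpecial_of_peirce_triple h2 hz hw hspan0 hspan1 hli hd hee hez hew hs ht hzw
  have hst := (mul_eq_zero.1 (key hz hw hez hew hzw)).resolve_left hβ
  have hts := (mul_eq_zero.1 (key hw hz hew hez hwz)).resolve_left (neg_ne_zero.2 hβ)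
  obtain h | h := mul_eq_zero.1 hst <;> obtain h' | h' := mul_eq_zero.1 hts
  · exact hJ.isSpecial_of_unit_triple h2 hz hw hspan0 hspan1 hli hd hee hez hew
      (sub_eq_zero.1 h).symm (sub_eq_zero.1 h').symm hβ hzw
  · have h3 : (1 : k) = 0 := by linear_combination 2 * h - h'
    exact absurd h3 one_ne_zero
  · have h3 : (1 : k) = 0 := by linear_combination 2 * h' - h
    exact absurd h3 one_ne_zero
  · exact hJ.isSpecial_of_half_half h2 hz hw hspan0 hspan1 hli hd hee hez hew
      (sub_eq_zero.1 h').symm (sub_eq_zero.1 h).symm hzw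

/-- If `n² = 0`, then `n` acts on the odd part with square zero; both possible forms of the action
allow an arbitrary value of `zw` and have explicit matrix models. -/
theorem IsJordanSuperalgebra.isSpecial_of_nilpotent_triple (hJ : IsJordanSuperalgebra k 𝒥)
    (h2 : (2 : k) ≠ 0) (hz : z ∈ 𝒥 1) (hw : w ∈ 𝒥 1)
    (hspan0 : ∀ a ∈ 𝒥 0, ∃ c : k, a = c • n) (hspan1 : ∀ a ∈ 𝒥 1, ∃ p q : k, a = p • z + q • w)
    (hli : LinearIndependent k ![n, z, w]) (hd : Module.finrank k J = 3)
    (hnn : n * n = 0) (hnz : n * z = 0 ∨ n * z = w) (hnw : n * w = 0) :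
    IsSpecialSuperalgebra k 𝒥 := by
  obtain ⟨β, hzw⟩ := hspan0 (z * w) (hJ.mul_mem 1 1 z w hz hw)
  have hnn' : n * n = (0 : k) • n := by rw [hnn, zero_smul]
  have hnw' : n * w = (0 : k) • z + (0 : k) • w := by simp [hnw]
  obtain hnz | hnz := hnz
  · have hnz' : n * z = (0 : k) • z + (0 : k) • w := by simp [hnz]
    refine hJ.isSpecial_of_triple h2 hz hw hspan0 hspan1 hli hd (B := Matrix (Fin 4) (Fin 4) k)
      !![0, 0, 1, 0; 0, 0, 0, 0; 0, 0, 0, 0; 0, 0, 0, 0]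
      !![0, 1, 0, 0; 0, 0, 0, 0; 0, 0, 0, 0; 0, 0, 0, 0]
      !![0, 0, 0, 1; 0, 0, 2 * β, 0; 0, 0, 0, 0; 0, 0, 0, 0]
      ?_ hnn' ?_ hnz' ?_ hnw' ?_ hzw ?_
    · intro p q r h
      refine ⟨?_, ?_, ?_⟩
      · simpa using congrFun (congrFun h 0) 2
      · simpa using congrFun (congrFun h 0) 1
      · simpa using congrFun (congrFun h 0) 3
    all_goals
      ext i j
      fin_cases i <;> fin_cases j <;> simp [Matrix.mul_apply, Fin.sum_univ_four]
  · have hnz' : n * z = (0 : k) • z + (1 : k) • w := by simp [hnz]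
    have h4 : 4 * β * 2⁻¹ = 2 * β := by field_simp; ring
    refine hJ.isSpecial_of_triple h2 hz hw hspan0 hspan1 hli hd (B := Matrix (Fin 3) (Fin 3) k)
      !![0, 0, 0; 1, 0, 0; 0, 0, 0] !![0, 0, 0; 0, 0, 4 * β; 0, 1, 0]
      !![0, 0, 0; 0, 0, 0; 2⁻¹, 0, 0] ?_ hnn' ?_ hnz' ?_ hnw' ?_ hzw ?_
    · intro p q r h
      refine ⟨?_, ?_, ?_⟩
      · simpa using congrFun (congrFun h 1) 0
      · simpa using congrFun (congrFun h 2) 1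
      · simpa [h2] using congrFun (congrFun h 2) 0
    all_goals
      ext i j
      fin_cases i <;> fin_cases j <;> simp [Matrix.mul_apply, Fin.sum_univ_three, h2, h4]

/-- The even part is spanned by an idempotent or by an element of square zero. In the first case
the odd part has a basis of Peirce eigenvectors, in the second the action on it is nilpotent. -/
theorem IsJordanSuperalgebra.isSpecial_of_finrank_one_two [FiniteDimensional k J]
    (hJ : IsJordanSuperalgebra k 𝒥)
    (h2 : (2 : k) ≠ 0) (h0 : Module.finrank k (𝒥 0) = 1) (h1 : Module.finrank k (𝒥 1) = 2) :
    IsSpecialSuperalgebra k 𝒥 := by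
  have hd : Module.finrank k J = 3 := by
    rw [← Submodule.finrank_add_eq_of_isCompl hJ.isCompl, h0, h1]
  have hdisj : ∀ a, a ∈ 𝒥 0 → a ∈ 𝒥 1 → a = 0 := fun a ha hb =>
    Submodule.disjoint_def.1 hJ.isCompl.disjoint a ha hb
  have hspan1 : ∀ z w, z ∈ 𝒥 1 → w ∈ 𝒥 1 → LinearIndependent k ![z, w] → ∀ a ∈ 𝒥 1,
      ∃ p q : k, a = p • z + q • w := by
    intro z w hz hw hzw a ha
    have hle : Submodule.span k {z, w} ≤ 𝒥 1 := by
      rw [Submodule.span_le]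
      rintro x (rfl | rfl) <;> assumption
    have hfin : Module.finrank k (Submodule.span k {z, w}) = 2 := by
      have := finrank_span_eq_card hzw
      rwa [Matrix.range_cons_cons_empty] at this
    rw [← Submodule.eq_of_le_of_finrank_eq hle (hfin.trans h1.symm)] at ha
    obtain ⟨p, q, h⟩ := Submodule.mem_span_pair.1 ha
    exact ⟨p, q, h.symm⟩
  have htriple : ∀ n z w, n ∈ 𝒥 0 → n ≠ 0 → z ∈ 𝒥 1 → w ∈ 𝒥 1 → LinearIndependent k ![z, w] →
      LinearIndependent k ![n, z, w] := by
    intro n z w hn hn0 hz hw hzw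
    refine linearIndependent_triple_of_notMem hzw fun h => hn0 (hdisj n hn ?_)
    refine Submodule.span_le.2 ?_ h
    rintro x (rfl | rfl) <;> assumption
  obtain ⟨⟨n, hn⟩, hn0, hspan⟩ := finrank_eq_one_iff'.1 h0
  have hn0 : n ≠ 0 := fun h => hn0 (Subtype.ext h)
  have hspan0 : ∀ a ∈ 𝒥 0, ∃ c : k, a = c • n := fun a ha => by
    obtain ⟨c, hc⟩ := hspan ⟨a, ha⟩
    exact ⟨c, congrArg Subtype.val hc.symm⟩
  obtain ⟨x, hx, hx0⟩ : ∃ x ∈ 𝒥 1, x ≠ 0 := by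
    refine (Submodule.ne_bot_iff _).1 fun h => ?_
    rw [h, finrank_bot] at h1
    exact absurd h1 (by norm_num)
  have hnot : ∀ z, ∃ y ∈ 𝒥 1, y ∉ Submodule.span k {z} := by
    intro z
    by_contra! h
    have h3 := Submodule.finrank_mono (show 𝒥 1 ≤ Submodule.span k {z} from h)
    have h4 := finrank_span_le_card (R := k) ({z} : Set J)
    simp only [Set.toFinset_card, Fintype.card_unique] at h4
    omega
  have hmem : ∀ m, m ∈ 𝒥 0 → ∀ y ∈ 𝒥 1, m * y ∈ 𝒥 1 := fun m hm y hy => hJ.mul_mem 0 1 m y hm hy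
  have hcomm : ∀ m, m ∈ 𝒥 0 → ∀ y ∈ 𝒥 1, y * m = m * y := fun m hm y hy => by
    rw [hJ.supercomm 1 0 y m hy hm, mul_zero, superSign_zero, one_smul]
  obtain ⟨c, hnn⟩ := hspan0 (n * n) (hJ.mul_mem 0 0 n n hn hn)
  by_cases hc : c = 0
  · rw [hc, zero_smul] at hnn
    have hcube : ∀ y ∈ 𝒥 1, n * (n * (n * y)) = 0 := by
      intro y hy
      have h := hJ.super_jordan 0 0 0 1 n n n y hn hn hn hy
      simp only [zero_mul, mul_zero, zero_add, superSign_zero, one_smul, hnn,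
        hcomm n hn _ (hmem n hn y hy), hcomm n hn _ (hmem n hn _ (hmem n hn y hy))] at h
      refine (smul_eq_zero.1 (?_ : (2 : k) • (n * (n * (n * y))) = 0)).resolve_left h2
      linear_combination (norm := module) -h
    by_cases hL : ∃ y ∈ 𝒥 1, n * y ≠ 0
    · obtain ⟨z, hz, hnz⟩ := hL
      have hw := hmem n hn z hz
      have hz0 : z ≠ 0 := by
        rintro rfl
        exact hnz (mul_zero n)
      have hzw : LinearIndependent k ![z, n * z] := by
        refine linearIndependent_pair_of_notMem hz0 fun h => ?_
        obtain ⟨d, hd⟩ := Submodule.mem_span_singleton.1 h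
        have h3 := hcube z hz
        rw [← hd, mul_smul_comm, ← hd, smul_smul, mul_smul_comm, ← hd, smul_smul] at h3
        have h5 : d = 0 := by simpa using (smul_eq_zero.1 h3).resolve_right hz0
        rw [← hd, h5, zero_smul] at hnz
        exact hnz rfl
      refine hJ.isSpecial_of_nilpotent_triple h2 hz hw hspan0 (hspan1 z _ hz hw hzw)
        (htriple n z _ hn hn0 hz hw hzw) hd hnn (.inr rfl) ?_
      obtain ⟨p, q, h⟩ := hspan1 z _ hz hw hzw _ (hmem n hn _ hw)
      have h3 := hcube z hz
      rw [h, mul_add, mul_smul_comm, mul_smul_comm, h] at h3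
      obtain ⟨h4, h5⟩ := LinearIndependent.pair_iff.1 hzw (q * p) (p + q * q)
        (by linear_combination (norm := module) h3)
      have hq : q * q * q = 0 := by linear_combination q * h5 - h4
      have hq : q = 0 := by simpa using hq
      have hp : p = 0 := by simpa [hq] using h5
      rw [h, hp, hq, zero_smul, zero_smul, add_zero]
    · push Not at hL
      obtain ⟨y, hy, hyx⟩ := hnot x
      have hxy := linearIndependent_pair_of_notMem hx0 hyx
      exact hJ.isSpecial_of_nilpotent_triple h2 hx hy hspan0 (hspan1 x y hx hy hxy)
        (htriple n x y hn hn0 hx hy hxy) hd hnn (.inl (hL x hx)) (hL y hy)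
  · obtain ⟨e, he, he0, hee, hspan0⟩ : ∃ e ∈ 𝒥 0, e ≠ 0 ∧ e * e = e ∧
        ∀ a ∈ 𝒥 0, ∃ c : k, a = c • e := by
      refine ⟨c⁻¹ • n, Submodule.smul_mem _ _ hn, smul_ne_zero (inv_ne_zero hc) hn0, ?_, ?_⟩
      · rw [smul_mul_smul_comm, hnn, smul_smul, mul_assoc, inv_mul_cancel₀ hc, mul_one]
      · intro a ha
        obtain ⟨d, rfl⟩ := hspan0 a ha
        exact ⟨d * c, by rw [smul_smul, mul_assoc, mul_inv_cancel₀ hc, mul_one]⟩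
    have hcubic : ∀ y ∈ 𝒥 1, (3 : k) • (e * (e * y)) = e * y + (2 : k) • (e * (e * (e * y))) := by
      intro y hy
      have h := hJ.super_jordan 0 0 0 1 e e e y he he he hy
      simp only [zero_mul, mul_zero, zero_add, superSign_zero, one_smul, hee,
        hcomm e he _ (hmem e he y hy), hcomm e he _ (hmem e he _ (hmem e he y hy))] at h
      linear_combination (norm := module) h
    have heig : ∀ z, ∃ y ∈ 𝒥 1, y ∉ Submodule.span k {z} ∧
        ∃ s : k, e * y = s • y ∧ (s = 0 ∨ 2 * s = 1 ∨ s = 1) := by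
      intro z
      obtain ⟨y, hy, hyz⟩ := hnot z
      exact exists_eigenvector_notMem h2 (LinearMap.mulLeft k e) (hmem e he) hy hyz (hcubic y hy)
    obtain ⟨z, hz, hz0, s, hez, hs⟩ := heig 0
    obtain ⟨w, hw, hwz, t, hew, ht⟩ := heig z
    have hzw : LinearIndependent k ![z, w] := by
      refine linearIndependent_pair_of_notMem ?_ hwz
      rintro rfl
      exact hz0 (zero_mem _)
    exact hJ.isSpecial_of_idempotent_triple h2 he hz hw hspan0 (hspan1 z w hz hw hzw)
      (htriple e z w he he0 hz hw hzw) hd hee hez hew hs ht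

theorem IsJordanSuperalgebra.isSpecial_of_finrank_le_three [IsAlgClosed k] [FiniteDimensional k J]
    (hJ : IsJordanSuperalgebra k 𝒥) (h2 : (2 : k) ≠ 0) (hd : Module.finrank k J ≤ 3) :
    IsSpecialSuperalgebra k 𝒥 := by
  have hadd := Submodule.finrank_add_eq_of_isCompl hJ.isCompl
  by_cases h1 : Module.finrank k (𝒥 1) ≤ 1
  · exact hJ.isSpecial_of_finrank_odd_le_one h2 hd h1
  by_cases h0 : Module.finrank k (𝒥 0) = 0
  · exact hJ.isSpecial_of_even_eq_bot h2 (Submodule.finrank_eq_zero.1 h0)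
  · exact hJ.isSpecial_of_finrank_one_two h2 (by omega) (by omega)

end TypeOneTwo

theorem mainTheorem4 (k : Type*) [Field k] [IsAlgClosed k] (hchar : ringChar k ≠ 2) :
    ∃ d : ℕ, IsLeast (exceptionalDimensions k) d ∧ 4 ≤ d ∧ d ≤ 7 := by
  have h2 : (2 : k) ≠ 0 := Ring.two_ne_zero hchar
  have h5 := KantorLieDouble.five_mem_exceptionalDimensions h2
  have hne : (exceptionalDimensions k).Nonempty := ⟨5, h5⟩
  refine ⟨sInf (exceptionalDimensions k), ⟨Nat.sInf_mem hne, fun n hn => Nat.sInf_le hn⟩, ?_,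
    (Nat.sInf_le h5).trans (by norm_num)⟩
  obtain ⟨J, _, _, _, _, 𝒥, ⟨hJ, hns⟩, hfin, hd⟩ := Nat.sInf_mem hne
  by_contra! hlt
  exact hns (hJ.isSpecial_of_finrank_le_three h2 (by omega))
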